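/- For a finite set $V$ and $P\subseteq[0,1]^V$, index $\mathbb R^{\{0\}\cup V}$ by $0$ and the elements of $V$, and let $\operatorname{cone}(P)=\{(\lambda,\lambda x):\lambda\ge 0,\ x\in P\}\subseteq\mathbb R^{\{0\}\cup V}$. Let $\mathrm{LS}_+(P)$ be the set of all $x\in\mathbb R^V$ for which there is a real symmetric positive semidefinite matrix $Y$, indexed by $\{0\}\cup V$, with $Ye_0=\operatorname{diag}(Y)=(1,x)$ and $Ye_i,\ Y(e_0-e_i)\in\operatorname{cone}(P)$ for all $i\in V$. For a finite simple graph $G$ put $$\mathrm{FRAC}(G)=\{x\in[0,1]^{V(G)}: x_i+x_j\le 1\ \text{ for all } \{i,j\}\in E(G)\},$$ and let $r_+(G)$ be the least $k\ge 0$ such that $\mathrm{LS}_+^k(\mathrm{FRAC}(G))$ is the convex hull of $\mathrm{FRAC}(G)\cap\{0,1\}^{V(G)}$. The graph $G$ is $\ell$-minimal if $r_+(G)=\ell$ and $|V(G)|=3\ell$. Its edge density is $d(G)=|E(G)|/\binom{|V(G)|}{2}$. For $k\ge 3$ and $S\subseteq\{4,\dots,k\}$ let $\mathcal A_{k,S}$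 be the graph with vertices $1,2,3$ and $i_0,i_1,i_2$ $(4\le i\le k)$, whose edges are $\{1,2\},\{2,3\},\{1,3\}$; $\{i_0,i_1\},\{i_0,i_2\},\{i_1,2\},\{i_1,3\},\{i_2,1\}$ for $4\le i\le k$; $\{i_2,j_1\}$ for $4\le i<j\le k$; and $\{i_2,2\}$ for $i\in S$. **Proposition.** For every integer $\ell\ge 1$, there exist $\ell$-minimal graphs, and the minimum $d^-(\ell)$ and maximum $d^+(\ell)$ of the edge densities of all $\ell$-minimal graphs satisfy $$d^-(\ell)\le\frac{\ell^2+7\ell-2}{9\ell^2-3\ell},\qquad d^+(\ell)\ge\frac{\ell^2+9\ell-4}{9\ell^2-3\ell}.$$ Moreover, with $k=\ell+2$, the graphs $\mathcal A_{k,\emptyset}$ and $\mathcal A_{k,\{4,\dots,k\}}$ are $\ell$-minimal, and $$d(\mathcal A_{k,\emptyset})=\frac{\ell^2+7\ell-2}{9\ell^2-3\ell},\qquad d(\mathcal A_{k,\{4,\dots,k\}})=\frac{\ell^2+9\ell-4}{9\ell^2-3\ell}.$$ -/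

import Mathlib

open scoped Matrix

noncomputable section

/-- The homogenized cone of `P ⊆ ℝ^V`: all vectors `(t, t x)` with `t ≥ 0` and `x ∈ P`.
The extra coordinate `0` is `none : Option V`, the coordinate `i : V` is `some i`. -/
def homCone {V : Type*} (P : Set (V → ℝ)) : Set (Option V → ℝ) :=
  {y | ∃ t : ℝ, 0 ≤ t ∧ ∃ x ∈ P, y none = t ∧ ∀ i, y (some i) = t * x i}

/-- The lifted set of the Lovász–Schrijver SDP operator: real symmetric positive semidefinite
matrices `Y` indexed by `{0} ∪ V` with `Y e₀ = diag Y` and `Y eᵢ, Y (e₀ - eᵢ) ∈ cone P`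
for every `i ∈ V`. -/
def LSPlusLift {V : Type*} (P : Set (V → ℝ)) : Set (Matrix (Option V) (Option V) ℝ) :=
  {Y | Y.PosSemidef ∧ (∀ a, Y a none = Y a a) ∧
    ∀ i : V, (fun a => Y a (some i)) ∈ homCone P ∧
      (fun a => Y a none - Y a (some i)) ∈ homCone P}

/-- The Lovász–Schrijver operator `LS₊`: all `x` with `Y e₀ = (1, x)` for some lifted `Y`. -/
def LSPlus {V : Type*} (P : Set (V → ℝ)) : Set (V → ℝ) :=
  {x | ∃ Y ∈ LSPlusLift P, Y none none = 1 ∧ ∀ i, Y (some i) none = x i}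

/-- The integer hull of `P`: the convex hull of `P ∩ {0,1}^V`. -/
def integerHull {V : Type*} (P : Set (V → ℝ)) : Set (V → ℝ) :=
  convexHull ℝ {x | x ∈ P ∧ ∀ i, x i = 0 ∨ x i = 1}

/-- `r` is the `LS₊`-rank of `P`: the least `k` with `LS₊^k P` equal to the integer hull. -/
def IsLSPlusRank {V : Type*} (P : Set (V → ℝ)) (r : ℕ) : Prop :=
  IsLeast {k : ℕ | LSPlus^[k] P = integerHull P} r

/-- The fractional stable set polytope of a graph. -/
def fracStab {V : Type*} (G : SimpleGraph V) : Set (V → ℝ) :=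
  {x | (∀ i, 0 ≤ x i ∧ x i ≤ 1) ∧ ∀ i j, G.Adj i j → x i + x j ≤ 1}

/-- `G` is `ℓ`-minimal: it has `LS₊`-rank `ℓ` and exactly `3ℓ` vertices. -/
def IsEllMinimal {V : Type*} [Fintype V] (ℓ : ℕ) (G : SimpleGraph V) : Prop :=
  IsLSPlusRank (fracStab G) ℓ ∧ Fintype.card V = 3 * ℓ

/-- The edge density `|E(G)| / binom(|V(G)|, 2)`. -/
def graphEdgeDensity {V : Type*} [Fintype V] (G : SimpleGraph V) : ℝ :=
  (G.edgeSet.ncard : ℝ) / ((Fintype.card V).choose 2 : ℝ)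

/-- The set of edge densities of all `ℓ`-minimal graphs. -/
def minimalDensities (ℓ : ℕ) : Set ℝ :=
  {d | ∃ (V : Type) (_ : Fintype V) (G : SimpleGraph V),
    IsEllMinimal ℓ G ∧ graphEdgeDensity G = d}

/-- `d⁻(ℓ)`, the minimum edge density among `ℓ`-minimal graphs. -/
def dMinus (ℓ : ℕ) : ℝ := sInf (minimalDensities ℓ)

/-- `d⁺(ℓ)`, the maximum edge density among `ℓ`-minimal graphs. -/
def dPlus (ℓ : ℕ) : ℝ := sSup (minimalDensities ℓ)

/-- The vertices `{1, 2, 3} ∪ {i₀, i₁, i₂ : 4 ≤ i ≤ k}`: here `Sum.inl 0`, `Sum.inl 1`,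
`Sum.inl 2` are the vertices `1`, `2`, `3`, and `Sum.inr (i, c)` is the vertex `i_c`. -/
abbrev AVertex (k : ℕ) : Type := Fin 3 ⊕ ({i : ℕ // i ∈ Finset.Icc 4 k} × Fin 3)

/-- The edges of `𝒜_{k,S}`, each listed in one orientation. -/
def AEdge (k : ℕ) (S : Finset ℕ) : AVertex k → AVertex k → Prop
  -- the triangle on `1, 2, 3`
  | .inl u, .inl v => u ≠ v
  -- `{i₀, i₁}`, `{i₀, i₂}`, and `{i₂, j₁}` for `i < j`
  | .inr (i, a), .inr (j, b) =>
      (i = j ∧ a = 0 ∧ (b = 1 ∨ b = 2)) ∨ (i.1 < j.1 ∧ a = 2 ∧ b = 1)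
  -- `{i₁, 2}`, `{i₁, 3}`, `{i₂, 1}`, and `{i₂, 2}` for `i ∈ S`
  | .inr (i, a), .inl v =>
      (a = 1 ∧ (v = 1 ∨ v = 2)) ∨ (a = 2 ∧ v = 0) ∨ (a = 2 ∧ v = 1 ∧ i.1 ∈ S)
  | .inl _, .inr _ => False

/-- The graph `𝒜_{k,S}` for `k ≥ 3` and `S ⊆ {4, …, k}`. -/
def graphA (k : ℕ) (S : Finset ℕ) : SimpleGraph (AVertex k) :=
  SimpleGraph.fromRel (AEdge k S)

end

/-! Both witnesses are stretched cliques: over a linear order with d = ℓ - 1 elements, each element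
carries a three-vertex path attached to a common triangle. The point is that their rank is d + 1, a
third of the number of vertices. The densities are then an edge count, and the extrema exist because
a fixed number of vertices allows finitely many densities.

Upper bound, for every graph (`valid_iterate_LSPlus`): an inequality with nonnegative coefficients
that holds for stable sets and has at most 3k support vertices holds on the k-th iterate. A support
vertex with at most one neighbour in the support is eliminated by subtracting an edge or bound
inequality. Otherwise fixing any support variable to 1 eliminates at least three support vertices,
and `LSPlus_valid_of_supp` passes from these faces to all of LS₊ by positive semidefiniteness.

Lower bound (`exists_sum_gt_of_card`): after d iterations some point still has coordinate sum above
d + 1, the stability number. In the induction step, let A be the sum of y yᵀ over the homogenized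
incidence vectors y of the maximum stable sets; it attains the bound exactly, and it is moved to A +
εZ. For small ε the cone conditions on a column are first-order conditions modulo the span of the
tight vectors that make up the column, and semidefiniteness only needs Z to be positive on the
kernel of A, the line through (-(d + 1), 1, …, 1). The first-order conditions require points of the
previous iterate with sum above the bound and prescribed behaviour on one path. These come from
smaller stretched cliques by substituting coordinates, complements and constants, which is
compatible with LS₊ (`substPoint_mem_LSPlus`): either a path is added with its middle chosen, or a
path is contracted onto a clique vertex. -/

/-! ### Homogenized cones and basic properties of LS₊ -/

section Cone

variable {V : Type*} {P : Set (V → ℝ)}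

theorem homCone_smul {y : Option V → ℝ} (hy : y ∈ homCone P) {c : ℝ} (hc : 0 ≤ c) :
    c • y ∈ homCone P := by
  obtain ⟨t, ht, x, hx, h0, h1⟩ := hy
  refine ⟨c * t, mul_nonneg hc ht, x, hx, by simp [h0], fun i => ?_⟩
  simp [h1, mul_assoc]

theorem homCone_add (hP : Convex ℝ P) {y z : Option V → ℝ} (hy : y ∈ homCone P)
    (hz : z ∈ homCone P) : y + z ∈ homCone P := by
  obtain ⟨t, ht, x, hx, h0, h1⟩ := hy
  obtain ⟨s, hs, w, hw, g0, g1⟩ := hz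
  rcases (add_nonneg ht hs).eq_or_lt with h | h
  · have ht' : t = 0 := by linarith
    have hs' : s = 0 := by linarith
    exact ⟨0, le_rfl, x, hx, by simp [h0, g0, ht', hs'], fun i => by simp [h1, g1, ht', hs']⟩
  · refine ⟨t + s, h.le, (t / (t + s)) • x + (s / (t + s)) • w,
      hP hx hw (by positivity) (by positivity) (by field_simp), by simp [h0, g0], fun i => ?_⟩
    simp only [Pi.add_apply, h1, g1, Pi.smul_apply, smul_eq_mul]
    field_simp

theorem zero_mem_homCone (hP : P.Nonempty) : (0 : Option V → ℝ) ∈ homCone P := by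
  obtain ⟨x, hx⟩ := hP
  exact ⟨0, le_rfl, x, hx, rfl, fun i => by simp⟩

theorem homCone_sum (hP : Convex ℝ P) (hne : P.Nonempty) {ι : Type*} (s : Finset ι)
    (f : ι → Option V → ℝ) (hf : ∀ i ∈ s, f i ∈ homCone P) : ∑ i ∈ s, f i ∈ homCone P :=
  Finset.sum_induction _ (· ∈ homCone P) (fun _ _ ha hb => homCone_add hP ha hb)
    (zero_mem_homCone hne) hf

theorem mem_of_mem_homCone {y : Option V → ℝ} (hy : y ∈ homCone P) (h1 : y none = 1) :
    (fun i => y (some i)) ∈ P := by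
  obtain ⟨t, ht, x, hx, h0, h2⟩ := hy
  have : t = 1 := by rw [← h0, h1]
  have hxy : (fun i => y (some i)) = x := by ext i; rw [h2, this, one_mul]
  rwa [hxy]

theorem mem_homCone_of_mem {y : Option V → ℝ} (h1 : y none = 1)
    (hy : (fun i => y (some i)) ∈ P) : y ∈ homCone P :=
  ⟨1, zero_le_one, _, hy, h1, fun i => by simp⟩

theorem LSPlusLift_smul {Y : Matrix (Option V) (Option V) ℝ} (hY : Y ∈ LSPlusLift P) {c : ℝ}
    (hc : 0 ≤ c) : c • Y ∈ LSPlusLift P := by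
  obtain ⟨h1, h2, h3⟩ := hY
  refine ⟨h1.smul hc, fun a => by simp [h2 a], fun i => ⟨homCone_smul (h3 i).1 hc, ?_⟩⟩
  have := homCone_smul (h3 i).2 hc
  convert this using 1
  ext a
  simp [mul_sub]

theorem LSPlusLift_add (hP : Convex ℝ P) {Y Z : Matrix (Option V) (Option V) ℝ}
    (hY : Y ∈ LSPlusLift P) (hZ : Z ∈ LSPlusLift P) : Y + Z ∈ LSPlusLift P := by
  obtain ⟨h1, h2, h3⟩ := hY
  obtain ⟨g1, g2, g3⟩ := hZ
  refine ⟨h1.add g1, fun a => by simp [h2 a, g2 a],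
    fun i => ⟨homCone_add hP (h3 i).1 (g3 i).1, ?_⟩⟩
  have := homCone_add hP (h3 i).2 (g3 i).2
  convert this using 1
  ext a
  simp only [Matrix.add_apply, Pi.add_apply]
  ring

theorem convex_LSPlus (hP : Convex ℝ P) : Convex ℝ (LSPlus P) := by
  rintro x ⟨Y, hY, hY0, hYx⟩ w ⟨Z, hZ, hZ0, hZw⟩ a b ha hb hab
  exact ⟨a • Y + b • Z, LSPlusLift_add hP (LSPlusLift_smul hY ha) (LSPlusLift_smul hZ hb),
    by simp [hY0, hZ0, hab], fun i => by simp [hYx, hZw]⟩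

theorem LSPlusLift_col_none [Nonempty V] (hP : Convex ℝ P)
    {Y : Matrix (Option V) (Option V) ℝ} (hY : Y ∈ LSPlusLift P) :
    (fun a => Y a none) ∈ homCone P := by
  obtain ⟨i⟩ := ‹Nonempty V›
  have := homCone_add hP (hY.2.2 i).1 (hY.2.2 i).2
  convert this using 1
  ext a
  simp

theorem LSPlus_subset [Nonempty V] (hP : Convex ℝ P) : LSPlus P ⊆ P := by
  rintro x ⟨Y, hY, h0, hx⟩
  have := mem_of_mem_homCone (LSPlusLift_col_none hP hY) h0
  simpa [hx] using this

/-- The rank-one matrix of the homogenized point is a lift: as the coordinates are 0 or 1, each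
required column is zero or the point itself. -/
theorem mem_LSPlus_of_zero_one [Finite V] {x : V → ℝ} (hx : x ∈ P)
    (h01 : ∀ i, x i = 0 ∨ x i = 1) : x ∈ LSPlus P := by
  set y : Option V → ℝ := fun a => a.elim 1 x with hy
  have hyc : y ∈ homCone P := mem_homCone_of_mem rfl hx
  refine ⟨Matrix.vecMulVec y y, ⟨?_, ?_, fun i => ⟨?_, ?_⟩⟩, by simp [Matrix.vecMulVec_apply, hy],
    fun i => by simp [Matrix.vecMulVec_apply, hy]⟩
  · simpa using Matrix.posSemidef_vecMulVec_self_star y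
  · rintro (_ | i)
    · simp [Matrix.vecMulVec_apply, hy]
    · rcases h01 i with h | h <;> simp [Matrix.vecMulVec_apply, hy, h]
  · have := homCone_smul hyc (c := x i) (by rcases h01 i with h | h <;> simp [h])
    convert this using 1
    ext a
    simp [Matrix.vecMulVec_apply, hy, mul_comm]
  · have := homCone_smul hyc (c := 1 - x i) (by rcases h01 i with h | h <;> simp [h])
    convert this using 1
    ext a
    simp [Matrix.vecMulVec_apply, hy]
    ring

theorem convex_iterate_LSPlus (hP : Convex ℝ P) (k : ℕ) : Convex ℝ (LSPlus^[k] P) := by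
  induction k with
  | zero => exact hP
  | succ k ih => rw [Function.iterate_succ_apply']; exact convex_LSPlus ih

theorem iterate_LSPlus_antitone [Nonempty V] (hP : Convex ℝ P) :
    Antitone fun k => LSPlus^[k] P :=
  antitone_nat_of_succ_le fun k => by
    simp only [Function.iterate_succ_apply']
    exact LSPlus_subset (convex_iterate_LSPlus hP k)

theorem mem_iterate_LSPlus_of_zero_one [Finite V] {x : V → ℝ} (hx : x ∈ P)
    (h01 : ∀ i, x i = 0 ∨ x i = 1) (k : ℕ) : x ∈ LSPlus^[k] P := by
  induction k with
  | zero => exact hx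
  | succ k ih => rw [Function.iterate_succ_apply']; exact mem_LSPlus_of_zero_one ih h01

theorem integerHull_subset_iterate_LSPlus [Finite V] (hP : Convex ℝ P) (k : ℕ) :
    integerHull P ⊆ LSPlus^[k] P :=
  convexHull_min (fun _ hx => mem_iterate_LSPlus_of_zero_one hx.1 hx.2 k)
    (convex_iterate_LSPlus hP k)

end Cone

/-! ### Compatibility of LS₊ with substitution of literals -/

section Substitution

variable {V W : Type*}

/-- The value of a literal on a homogenized vector: the literal `(o, true)` reads the coordinate
`o`, and `(o, false)` its complement. -/
def litValue (l : Option V × Bool) (y : Option V → ℝ) : ℝ :=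
  if l.2 then y l.1 else y none - y l.1

/-- The literal attached to a coordinate of the target, the homogenizing one included. -/
def extendLit (φ : W → Option V × Bool) (a : Option W) : Option V × Bool :=
  a.elim (none, true) φ

/-- Substituting literals for coordinates, in homogenized form. -/
def substLit (φ : W → Option V × Bool) (y : Option V → ℝ) : Option W → ℝ :=
  fun a => litValue (extendLit φ a) y

/-- Substituting literals for coordinates. -/
def substPoint (φ : W → Option V × Bool) (x : V → ℝ) : W → ℝ :=
  fun w => litValue (φ w) (fun a => a.elim 1 x)

theorem substLit_mem_homCone {φ : W → Option V × Bool} {P : Set (V → ℝ)} {Q : Set (W → ℝ)}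
    (h : ∀ x ∈ P, substPoint φ x ∈ Q) {y : Option V → ℝ} (hy : y ∈ homCone P) :
    substLit φ y ∈ homCone Q := by
  obtain ⟨t, ht, x, hx, h0, h1⟩ := hy
  have hy' : ∀ a, y a = t * (fun a : Option V => a.elim 1 x) a := by
    rintro (_ | i)
    · simp [h0]
    · simp [h1]
  refine ⟨t, ht, _, h x hx, by simp [substLit, extendLit, litValue, h0], fun w => ?_⟩
  simp only [substLit, extendLit, substPoint, litValue, Option.elim_some, hy']
  split_ifs <;> simp [mul_sub]

/-- The rows of the substitution, as a matrix. -/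
noncomputable def litMatrix [DecidableEq V] (φ : W → Option V × Bool) :
    Matrix (Option W) (Option V) ℝ :=
  fun a b => litValue (extendLit φ a) (Pi.single b 1)

theorem litMatrix_mulVec [Fintype V] [DecidableEq V] (φ : W → Option V × Bool) (y : Option V → ℝ) :
    litMatrix φ *ᵥ y = substLit φ y := by
  ext a
  simp only [Matrix.mulVec, dotProduct, litMatrix, substLit, litValue]
  split_ifs <;> simp [Pi.single_apply, sub_mul]

/-- With L the matrix of the substitution, L Y Lᵀ is a lift of the image. Its columns are images of
columns of Y or of their complements, so negating a literal merely interchanges the two cone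
conditions. -/
theorem substPoint_mem_LSPlus [Fintype V] [Finite W] [Nonempty V] {φ : W → Option V × Bool}
    {P : Set (V → ℝ)} {Q : Set (W → ℝ)} (hP : Convex ℝ P)
    (h : ∀ x ∈ P, substPoint φ x ∈ Q) {x : V → ℝ} (hx : x ∈ LSPlus P) :
    substPoint φ x ∈ LSPlus Q := by
  classical
  have := Fintype.ofFinite W
  obtain ⟨Y, hY, h0, hYx⟩ := hx
  have hsymm : ∀ a b, Y a b = Y b a := fun a b => by
    have := hY.1.isHermitian.apply b a
    simpa using this
  have hne : P.Nonempty := ⟨x, LSPlus_subset hP ⟨Y, hY, h0, hYx⟩⟩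
  have hentry : ∀ a b, (litMatrix φ * Y * (litMatrix φ)ᴴ) a b =
      litValue (extendLit φ a) (fun c => litValue (extendLit φ b) (fun d => Y c d)) := by
    intro a b
    have e1 : (litMatrix φ * Y * (litMatrix φ)ᴴ) a b =
        (litMatrix φ *ᵥ (fun c => (litMatrix φ *ᵥ (fun d => Y c d)) b)) a := by
      rw [Matrix.mul_assoc]
      simp [Matrix.mul_apply, Matrix.mulVec, dotProduct, mul_comm]
    have e2 : ∀ c, litMatrix φ *ᵥ (fun d => Y c d) = substLit φ (fun d => Y c d) :=
      fun c => litMatrix_mulVec φ _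
    rw [e1, litMatrix_mulVec]
    simp only [e2]
    rfl
  have hcol0 := LSPlusLift_col_none hP hY
  -- Constant literals lead to column 0 and to the zero vector, so both cone conditions are needed
  -- at the index `none` too.
  have hcol : ∀ o : Option V, (fun c => Y c o) ∈ homCone P := by
    rintro (_ | i)
    · exact hcol0
    · exact (hY.2.2 i).1
  have hcol' : ∀ o : Option V, (fun c => Y c none - Y c o) ∈ homCone P := by
    rintro (_ | i)
    · simp only [sub_self]
      exact zero_mem_homCone hne
    · exact (hY.2.2 i).2
  refine ⟨litMatrix φ * Y * (litMatrix φ)ᴴ, ⟨hY.1.mul_mul_conjTranspose_same _, ?_, ?_⟩, ?_, ?_⟩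
  · intro a
    rw [hentry, hentry]
    rcases extendLit φ a with ⟨o, _ | _⟩
    · simp [litValue, extendLit, hsymm none o, hY.2.1 o]
    · simp [litValue, extendLit, hY.2.1 o]
  · intro w
    simp only [hentry]
    rcases hl : extendLit φ (some w) with ⟨o, _ | _⟩
    · refine ⟨?_, ?_⟩
      · exact substLit_mem_homCone h (hcol' o)
      · have := substLit_mem_homCone h (hcol o)
        convert this using 1
        ext a
        have hnone : extendLit φ none = (none, true) := rfl
        rcases h' : extendLit φ a with ⟨p, _ | _⟩ <;> simp [substLit, litValue, hnone, h']
        ring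
    · refine ⟨?_, ?_⟩
      · exact substLit_mem_homCone h (hcol o)
      · have := substLit_mem_homCone h (hcol' o)
        convert this using 1
        ext a
        have hnone : extendLit φ none = (none, true) := rfl
        rcases h' : extendLit φ a with ⟨p, _ | _⟩ <;> simp [substLit, litValue, hnone, h']
        ring
  · rw [hentry]
    simp [litValue, extendLit, h0]
  · intro w
    rw [hentry]
    have : (fun c => Y c none) = fun a : Option V => a.elim 1 x := by
      ext a
      rcases a with _ | i
      · exact h0
      · exact hYx i
    simp only [substPoint, extendLit, Option.elim_some, Option.elim_none, ← this]
    simp [litValue]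

theorem substPoint_mem_iterate_LSPlus [Fintype V] [Finite W] [Nonempty V]
    {φ : W → Option V × Bool} {P : Set (V → ℝ)} {Q : Set (W → ℝ)} (hP : Convex ℝ P)
    (h : ∀ x ∈ P, substPoint φ x ∈ Q) (k : ℕ) :
    ∀ x ∈ LSPlus^[k] P, substPoint φ x ∈ LSPlus^[k] Q := by
  induction k with
  | zero => exact h
  | succ k ih =>
    simp only [Function.iterate_succ_apply']
    exact fun x hx => substPoint_mem_LSPlus (convex_iterate_LSPlus hP k) ih hx

end Substitution

/-! ### Rank at most a third of the number of vertices -/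

section UpperBound

variable {V : Type*}

/-- Let s be the value of the inequality at x and Y' the block of Y without index 0. For a i > 0,
column i is x i times a point of P whose i-th coordinate is 1 (or x i = 0), whence aᵀY'a ≤ b s.
Testing semidefiniteness on (-s, a) gives s² ≤ aᵀY'a. So s² ≤ b s, and s ≤ b. -/
theorem LSPlus_valid_of_supp [Fintype V] {P : Set (V → ℝ)} {a : V → ℝ} (ha : ∀ i, 0 ≤ a i)
    {b : ℝ} (hb : 0 ≤ b)
    (h : ∀ i, 0 < a i → ∀ y ∈ P, y i = 1 → ∑ j, a j * y j ≤ b)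
    {x : V → ℝ} (hx : x ∈ LSPlus P) : ∑ j, a j * x j ≤ b := by
  obtain ⟨Y, ⟨hpsd, hdiag, hcol⟩, h0, hYx⟩ := hx
  have hsymm : ∀ a b, Y a b = Y b a := fun a b => by
    have := hpsd.isHermitian.apply b a
    simpa using this
  set s := ∑ j, a j * x j with hs
  have h1 : ∀ i, a i * ∑ j, a j * Y (some j) (some i) ≤ a i * (b * x i) := by
    intro i
    rcases (ha i).eq_or_lt with hi | hi
    · simp [← hi]
    refine mul_le_mul_of_nonneg_left ?_ hi.le
    obtain ⟨t, ht, y, hy, e0, e1⟩ := (hcol i).1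
    have htx : t = x i := by rw [← e0, ← hYx]; exact hsymm _ _
    have hyi : t * y i = t := by rw [← e1 i, htx, ← hYx]; exact (hdiag _).symm
    simp only [e1]
    rw [← htx]
    rcases eq_or_ne t 0 with h' | h'
    · simp [h']
    have hyi1 : y i = 1 := by
      have := mul_left_cancel₀ h' (hyi.trans (mul_one t).symm)
      exact this
    have := mul_le_mul_of_nonneg_left (h i hi y hy hyi1) ht
    calc ∑ j, a j * (t * y j) = t * ∑ j, a j * y j := by
          rw [Finset.mul_sum]; exact Finset.sum_congr rfl fun j _ => by ring
      _ ≤ b * t := by linarith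
  have h2 : ∑ i, a i * ∑ j, a j * Y (some j) (some i) ≤ b * s := by
    refine (Finset.sum_le_sum fun i _ => h1 i).trans_eq ?_
    rw [hs, Finset.mul_sum]
    exact Finset.sum_congr rfl fun j _ => by ring
  have h3 := hpsd.dotProduct_mulVec_nonneg (fun o : Option V => o.elim (-s) a)
  have h4 : 0 ≤ ∑ i, a i * ∑ j, a j * Y (some j) (some i) - s ^ 2 := by
    refine h3.trans_eq ?_
    have e : ∀ i, Y none (some i) = x i := fun i => by rw [hsymm, hYx]
    simp only [dotProduct, Matrix.mulVec, Fintype.sum_option, star_trivial, Option.elim_none,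
      Option.elim_some, h0, e, hYx]
    have e2 : ∑ i, x i * a i = s := by
      rw [hs]; exact Finset.sum_congr rfl fun j _ => by ring
    have e3 : ∑ i, a i * (x i * -s + ∑ j, Y (some i) (some j) * a j) =
        - s * s + ∑ i, a i * ∑ j, a j * Y (some j) (some i) := by
      rw [hs, Finset.mul_sum, ← hs, ← Finset.sum_add_distrib]
      refine Finset.sum_congr rfl fun i _ => ?_
      have : ∑ j, Y (some i) (some j) * a j = ∑ j, a j * Y (some j) (some i) :=
        Finset.sum_congr rfl fun j _ => by rw [hsymm, mul_comm]
      rw [this]; ring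
    rw [e2, e3]; ring
  by_contra! hlt
  nlinarith

theorem convex_fracStab (G : SimpleGraph V) : Convex ℝ (fracStab G) := by
  rintro x ⟨hx, hx'⟩ y ⟨hy, hy'⟩ a b ha hb hab
  refine ⟨fun i => ⟨?_, ?_⟩, fun i j hij => ?_⟩ <;>
    simp only [Pi.add_apply, Pi.smul_apply, smul_eq_mul]
  · have := (hx i).1; have := (hy i).1; positivity
  · nlinarith [(hx i).2, (hy i).2]
  · nlinarith [hx' i j hij, hy' i j hij]

open Classical in
theorem indicator_mem_fracStab {G : SimpleGraph V} {T : Set V} (hT : G.IsIndepSet T) :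
    (fun i => if i ∈ T then (1 : ℝ) else 0) ∈ fracStab G := by
  refine ⟨fun i => by beta_reduce; split_ifs <;> norm_num, fun i j hij => ?_⟩
  beta_reduce
  have : ¬ (i ∈ T ∧ j ∈ T) := fun h => hT h.1 h.2 hij.ne hij
  split_ifs <;> simp_all

open Classical in
-- The inner induction on the support size is needed because eliminating a vertex of low degree
-- stays within the same iterate. Each iteration pays for three support vertices: one vertex and two
-- of its neighbours.
theorem valid_iterate_LSPlus [Fintype V] [Nonempty V] (G : SimpleGraph V) (k : ℕ) :
    ∀ (n : ℕ) (a : V → ℝ) (b : ℝ), (∀ i, 0 ≤ a i) →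
      (Finset.univ.filter fun i => 0 < a i).card = n → n ≤ 3 * k →
      (∀ T : Finset V, G.IsIndepSet (T : Set V) → ∑ i ∈ T, a i ≤ b) →
      ∀ x ∈ LSPlus^[k] (fracStab G), ∑ j, a j * x j ≤ b := by
  induction k with
  | zero =>
    intro n a b ha hn hnk hT x _
    have h0 : ∀ i, a i = 0 := fun i => by
      have hc : (Finset.univ.filter fun i => 0 < a i) = ∅ := by
        rw [← Finset.card_eq_zero]; omega
      have := Finset.eq_empty_iff_forall_notMem.1 hc i
      simp at this
      linarith [ha i]
    have := hT ∅ (by simp)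
    simpa [h0] using this
  | succ k ihk =>
    intro n
    induction n using Nat.strong_induction_on with
    | _ n ihn =>
    intro a b ha hn hnk hT x hx
    have hb : 0 ≤ b := by simpa using hT ∅ (by simp)
    have hfrac : ∀ m, ∀ y ∈ LSPlus^[m] (fracStab G), y ∈ fracStab G := fun m y hy =>
      iterate_LSPlus_antitone (convex_fracStab G) (Nat.zero_le m) hy
    set N : V → Finset V := fun u => Finset.univ.filter fun v => 0 < a v ∧ G.Adj u v with hN
    by_cases hlow : ∃ u, 0 < a u ∧ (N u).card ≤ 1
    · obtain ⟨u, hu, hcard⟩ := hlow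
      have huniq : ∀ v w, 0 < a v → 0 < a w → G.Adj u v → G.Adj u w → v = w := by
        intro v w hv hw h1 h2
        exact Finset.card_le_one.1 hcard v (by simp [hN, hv, h1]) w (by simp [hN, hw, h2])
      -- The inequality a u * (x u + x v) ≤ a u is subtracted, v being the only support neighbour of
      -- u, if any. Truncation at 0 keeps the coefficients nonnegative.
      set a' : V → ℝ := fun w =>
        if w = u then 0 else if G.Adj u w then max (a w - a u) 0 else a w with ha'
      have ha'0 : ∀ w, 0 ≤ a' w := by
        intro w; simp only [ha']; split_ifs <;> simp [ha w]
      have hle : ∀ w, a' w ≤ a w := by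
        intro w; simp only [ha']; split_ifs
        · exact ha w
        · exact max_le (by linarith) (ha w)
        · exact le_rfl
      have hsub : (Finset.univ.filter fun i => 0 < a' i).card < n := by
        rw [← hn]
        refine Finset.card_lt_card (Finset.ssubset_iff_of_subset ?_ |>.2 ⟨u, by simp [hu], ?_⟩)
        · intro w hw
          simp only [Finset.mem_filter, Finset.mem_univ, true_and] at hw ⊢
          exact hw.trans_le (hle w)
        · simp [ha']
      have hvalid : ∀ T : Finset V, G.IsIndepSet (T : Set V) → ∑ i ∈ T, a' i ≤ b - a u := by
        intro T hTi
        -- Discarding vertices with a' = 0 leaves the sum unchanged. Then either `T1` contains a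
        -- neighbour of u, whose coefficient has dropped by a u, or u can be added to `T1`.
        set T1 := T.filter fun i => 0 < a' i with hT1
        have hT1i : G.IsIndepSet (T1 : Set V) := hTi.mono (Finset.coe_subset.2 (Finset.filter_subset _ _))
        have hsum : ∑ i ∈ T, a' i = ∑ i ∈ T1, a' i := by
          rw [hT1, Finset.sum_filter]
          refine Finset.sum_congr rfl fun i _ => ?_
          split_ifs with h
          · rfl
          · linarith [ha'0 i]
        have huT1 : u ∉ T1 := by simp [hT1, ha']
        have hT1pos : ∀ w ∈ T1, 0 < a' w := fun w hw => (Finset.mem_filter.1 hw).2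
        rw [hsum]
        by_cases hnb : ∃ v ∈ T1, G.Adj u v
        · obtain ⟨v, hv, huv⟩ := hnb
          have hav : 0 < a v := (hT1pos v hv).trans_le (hle v)
          have hv' : a' v = a v - a u := by
            have h1 := hT1pos v hv
            simp only [ha', if_neg huv.ne', if_pos huv] at h1 ⊢
            rcases max_choice (a v - a u) 0 with h | h
            · exact h
            · rw [h] at h1; exact absurd h1 (lt_irrefl _)
          have := hT T1 hT1i
          rw [← Finset.add_sum_erase _ _ hv] at this ⊢
          have h2 : ∑ i ∈ T1.erase v, a' i ≤ ∑ i ∈ T1.erase v, a i :=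
            Finset.sum_le_sum fun i _ => hle i
          linarith
        · push Not at hnb
          have hi : G.IsIndepSet ((insert u T1 : Finset V) : Set V) := by
            rw [Finset.coe_insert]
            refine Set.Pairwise.insert hT1i fun w hw _ => ⟨hnb w hw, fun h => hnb w hw h.symm⟩
          have := hT _ hi
          rw [Finset.sum_insert huT1] at this
          have h2 : ∑ i ∈ T1, a' i ≤ ∑ i ∈ T1, a i := Finset.sum_le_sum fun i _ => hle i
          linarith
      have hmain := ihn _ hsub a' (b - a u) ha'0 rfl (by omega) hvalid x hx
      have hxf := hfrac _ x hx
      have hkey : ∑ j, (a j - a' j) * x j ≤ a u := by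
        by_cases hex : ∃ v, 0 < a v ∧ G.Adj u v
        · obtain ⟨v, hv, huv⟩ := hex
          have hpt : ∀ j, (a j - a' j) * x j ≤
              (if j = u then a u * x u else 0) + (if j = v then a u * x v else 0) := by
            intro j
            by_cases hju : j = u
            · subst hju; simp [ha', huv.ne]
            · by_cases hjv : j = v
              · subst hjv
                simp only [ha', if_neg hju, if_pos huv, if_true, zero_add]
                refine mul_le_mul_of_nonneg_right ?_ (hxf.1 _).1
                linarith [le_max_left (a j - a u) 0]
              · have : a j = a' j := by
                  simp only [ha', if_neg hju]
                  split_ifs with h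
                  · have : a j = 0 := by
                      by_contra h0
                      exact hjv (huniq j v (lt_of_le_of_ne (ha j) (Ne.symm h0)) hv h huv)
                    rw [this, max_eq_right]; linarith
                  · rfl
                simp [this, hju, hjv]
          refine (Finset.sum_le_sum fun j _ => hpt j).trans ?_
          rw [Finset.sum_add_distrib]
          simp only [Finset.sum_ite_eq', Finset.mem_univ, if_true]
          nlinarith [hxf.2 u v huv]
        · push Not at hex
          have hpt : ∀ j, (a j - a' j) * x j ≤ (if j = u then a u * x u else 0) := by
            intro j
            by_cases hju : j = u
            · subst hju; simp [ha']
            · have : a j = a' j := by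
                simp only [ha', if_neg hju]
                split_ifs with h
                · have : a j = 0 := by
                    by_contra h0
                    exact hex j (lt_of_le_of_ne (ha j) (Ne.symm h0)) h
                  rw [this, max_eq_right]; linarith
                · rfl
              simp [this, hju]
          refine (Finset.sum_le_sum fun j _ => hpt j).trans ?_
          simp only [Finset.sum_ite_eq', Finset.mem_univ, if_true]
          nlinarith [(hxf.1 u).2]
      simp only [sub_mul, Finset.sum_sub_distrib] at hkey
      linarith
    · push Not at hlow
      rw [Function.iterate_succ_apply'] at hx
      refine LSPlus_valid_of_supp ha hb ?_ hx
      intro i hi y hy hyi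
      -- Where y i = 1 the neighbours of i vanish, so only coefficients outside the closed
      -- neighbourhood matter. A stable set there can be enlarged by i, which lowers their bound to
      -- b - a i.
      set a' : V → ℝ := fun w => if w = i ∨ G.Adj i w then 0 else a w with ha'
      have hyf := hfrac _ y hy
      have hsub : (Finset.univ.filter fun i => 0 < a' i).card ≤ 3 * k := by
        have hdisj : Disjoint (Finset.univ.filter fun i => 0 < a' i) (insert i (N i)) := by
          rw [Finset.disjoint_left]
          intro w hw hw'
          simp only [Finset.mem_filter, Finset.mem_univ, true_and] at hw
          have : w = i ∨ G.Adj i w := by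
            rcases Finset.mem_insert.1 hw' with h | h
            · exact Or.inl h
            · exact Or.inr (by simp [hN] at h; exact h.2)
          simp [ha', this] at hw
        have hun : (Finset.univ.filter fun i => 0 < a' i) ∪ (insert i (N i)) ⊆
            Finset.univ.filter fun i => 0 < a i := by
          intro w hw
          simp only [Finset.mem_union, Finset.mem_filter, Finset.mem_univ, true_and,
            Finset.mem_insert, hN] at hw ⊢
          rcases hw with h | h | h
          · simp only [ha'] at h
            split_ifs at h with h'
            · exact absurd h (lt_irrefl _)
            · exact h
          · rw [h]; exact hi
          · exact h.1
        have h1 := Finset.card_le_card hun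
        rw [Finset.card_union_of_disjoint hdisj, Finset.card_insert_of_notMem (by simp [hN]),
          hn] at h1
        have := hlow i hi
        omega
      have hvalid : ∀ T : Finset V, G.IsIndepSet (T : Set V) → ∑ j ∈ T, a' j ≤ b - a i := by
        intro T hTi
        set T1 := T.filter fun w => ¬ (w = i ∨ G.Adj i w) with hT1
        have hsum : ∑ j ∈ T, a' j = ∑ j ∈ T1, a j := by
          rw [hT1, Finset.sum_filter]
          refine Finset.sum_congr rfl fun j _ => ?_
          simp only [ha']
          split_ifs <;> simp_all
        have hiT1 : i ∉ T1 := by simp [hT1]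
        have hT1i : G.IsIndepSet (T1 : Set V) := hTi.mono (Finset.coe_subset.2 (Finset.filter_subset _ _))
        have hnb : ∀ w ∈ T1, ¬ G.Adj i w := fun w hw h =>
          (Finset.mem_filter.1 hw).2 (Or.inr h)
        have hins : G.IsIndepSet ((insert i T1 : Finset V) : Set V) := by
          rw [Finset.coe_insert]
          exact Set.Pairwise.insert hT1i fun w hw _ => ⟨hnb w hw, fun h => hnb w hw h.symm⟩
        have := hT _ hins
        rw [Finset.sum_insert hiT1] at this
        rw [hsum]; linarith
      have ha'0 : ∀ w, 0 ≤ a' w := by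
        intro w; simp only [ha']; split_ifs <;> simp [ha w]
      have hmain := ihk _ a' (b - a i) ha'0 rfl hsub hvalid y hy
      have hsum : ∑ j, a j * y j = ∑ j, a' j * y j + a i := by
        have hpt : ∀ j, a j * y j = a' j * y j + if j = i then a i else 0 := by
          intro j
          by_cases hji : j = i
          · subst hji; simp [ha', hyi]
          · by_cases hadj : G.Adj i j
            · have : y j = 0 := by
                have h1 := hyf.2 i j hadj
                have h2 := (hyf.1 j).1
                linarith
              simp [this, hji]
            · simp [ha', hji, hadj]
        rw [Finset.sum_congr rfl fun j _ => hpt j, Finset.sum_add_distrib]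
        simp
      linarith

theorem iterate_LSPlus_eq_integerHull [Fintype V] [Nonempty V] (G : SimpleGraph V) {k : ℕ}
    (hk : Fintype.card V ≤ 3 * k) :
    LSPlus^[k] (fracStab G) = integerHull (fracStab G) := by
  classical
  refine Set.Subset.antisymm (fun x hx => ?_)
    (integerHull_subset_iterate_LSPlus (convex_fracStab G) k)
  by_contra hxn
  have hfin : {x : V → ℝ | x ∈ fracStab G ∧ ∀ i, x i = 0 ∨ x i = 1}.Finite := by
    refine (Set.Finite.pi' (t := fun _ : V => ({0, 1} : Set ℝ))
      fun _ => Set.toFinite _).subset ?_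
    intro x hx i
    simpa using hx.2 i
  obtain ⟨f, c, hf1, hf2⟩ := geometric_hahn_banach_closed_point (convex_convexHull ℝ _)
    (hfin.isClosed_convexHull ℝ) hxn
  have hfx : ∀ y : V → ℝ, f y = ∑ i, f (Pi.single i 1) * y i := by
    intro y
    have := LinearMap.pi_apply_eq_sum_univ (f : (V → ℝ) →ₗ[ℝ] ℝ) y
    simp only [ContinuousLinearMap.coe_coe, smul_eq_mul] at this
    rw [this]
    refine Finset.sum_congr rfl fun i _ => ?_
    rw [mul_comm]
    congr 2
    ext j
    simp [Pi.single_apply, eq_comm]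
  -- Passing to positive parts can only increase the value at x ≥ 0, and it preserves validity
  -- because a stable set may be restricted to its positive coefficients.
  set a : V → ℝ := fun i => max (f (Pi.single i 1)) 0 with ha
  have hx0 : ∀ i, 0 ≤ x i := fun i =>
    ((iterate_LSPlus_antitone (convex_fracStab G) (Nat.zero_le k) hx : x ∈ fracStab G).1 i).1
  have hvalid : ∀ T : Finset V, G.IsIndepSet (T : Set V) → ∑ i ∈ T, a i ≤ c := by
    intro T hT
    set T1 := T.filter fun i => 0 < f (Pi.single i 1) with hT1
    have hT1i : G.IsIndepSet (T1 : Set V) := hT.mono (Finset.coe_subset.2 (Finset.filter_subset _ _))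
    have h1 := hf1 _ (subset_convexHull ℝ _
      ⟨indicator_mem_fracStab hT1i, fun i => by split_ifs <;> simp⟩)
    rw [hfx] at h1
    refine le_of_eq_of_le ?_ h1.le
    simp only [Finset.mem_coe, mul_ite, mul_one, mul_zero, Finset.sum_ite_mem, Finset.univ_inter]
    rw [hT1, Finset.sum_filter]
    refine Finset.sum_congr rfl fun i _ => ?_
    simp only [ha]
    split_ifs with h
    · exact max_eq_left h.le
    · exact max_eq_right (not_lt.1 h)
  have hmain := valid_iterate_LSPlus G k _ a c (fun i => le_max_right _ _) rfl
    ((Finset.card_le_univ _).trans hk) hvalid x hx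
  have : f x ≤ ∑ j, a j * x j := by
    rw [hfx]
    exact Finset.sum_le_sum fun i _ => mul_le_mul_of_nonneg_right (le_max_left _ _) (hx0 i)
  linarith

end UpperBound

/-! ### First-order perturbation of a lift -/

section Perturbation

open Filter Topology

/-- The part of the unit sphere where the form of B is nonpositive is compact, and the form of A is
positive there, hence bounded away from 0; a small multiple of B cannot outweigh it. On the rest of
the sphere both forms are nonnegative. -/
theorem eventually_posSemidef_add_smul {n : Type*} [Fintype n] {A B : Matrix n n ℝ}
    (hA : A.PosSemidef) (hB : B.IsHermitian)
    (h : ∀ x : n → ℝ, x ≠ 0 → x ⬝ᵥ A *ᵥ x = 0 → 0 < x ⬝ᵥ B *ᵥ x) :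
    ∀ᶠ ε in 𝓝[>] (0 : ℝ), (A + ε • B).PosSemidef := by
  have hcA : Continuous fun x : n → ℝ => x ⬝ᵥ A *ᵥ x := by fun_prop
  have hcB : Continuous fun x : n → ℝ => x ⬝ᵥ B *ᵥ x := by fun_prop
  have hA0 : ∀ x : n → ℝ, 0 ≤ x ⬝ᵥ A *ᵥ x := fun x => by
    simpa using hA.dotProduct_mulVec_nonneg x
  set S := Metric.sphere (0 : n → ℝ) 1 with hS
  have hScomp : IsCompact S := isCompact_sphere 0 1
  have hmain : ∀ᶠ ε in 𝓝[>] (0 : ℝ), ∀ x ∈ S, 0 ≤ x ⬝ᵥ A *ᵥ x + ε * (x ⬝ᵥ B *ᵥ x) := by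
    set K := S ∩ {x | x ⬝ᵥ B *ᵥ x ≤ 0} with hK
    have hKcomp : IsCompact K := hScomp.inter_right (isClosed_le hcB continuous_const)
    rcases K.eq_empty_or_nonempty with hKe | hKne
    · filter_upwards [self_mem_nhdsWithin] with ε (hε : 0 < ε) x hx
      have : 0 < x ⬝ᵥ B *ᵥ x := by
        by_contra! hle
        exact Set.notMem_empty x (hKe ▸ ⟨hx, hle⟩)
      have := hA0 x
      positivity
    · obtain ⟨x0, hx0, hmin⟩ := hKcomp.exists_isMinOn hKne hcA.continuousOn
      obtain ⟨x1, hx1, hmin1⟩ := hKcomp.exists_isMinOn hKne hcB.continuousOn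
      have hx0ne : x0 ≠ 0 := by
        rintro rfl
        have := hx0.1
        simp [hS] at this
      have hm : 0 < x0 ⬝ᵥ A *ᵥ x0 := by
        refine lt_of_le_of_ne (hA0 x0) fun h0 => ?_
        exact absurd (h x0 hx0ne h0.symm) (not_lt.2 hx0.2)
      have hlim : Tendsto (fun ε : ℝ => x0 ⬝ᵥ A *ᵥ x0 + ε * (x1 ⬝ᵥ B *ᵥ x1)) (𝓝[>] 0)
          (𝓝 (x0 ⬝ᵥ A *ᵥ x0 + 0 * (x1 ⬝ᵥ B *ᵥ x1))) :=
        Tendsto.mono_left (Continuous.tendsto (by fun_prop) 0) nhdsWithin_le_nhds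
      have hpos := hlim.eventually (lt_mem_nhds (show 0 < _ by simpa using hm))
      filter_upwards [self_mem_nhdsWithin, hpos] with ε (hε : 0 < ε) hlt x hx
      by_cases hBx : x ⬝ᵥ B *ᵥ x ≤ 0
      · have e1 : x0 ⬝ᵥ A *ᵥ x0 ≤ x ⬝ᵥ A *ᵥ x := hmin ⟨hx, hBx⟩
        have e2 : x1 ⬝ᵥ B *ᵥ x1 ≤ x ⬝ᵥ B *ᵥ x := hmin1 ⟨hx, hBx⟩
        nlinarith
      · have := hA0 x
        push Not at hBx
        positivity
  filter_upwards [hmain] with ε hε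
  refine Matrix.PosSemidef.of_dotProduct_mulVec_nonneg
    (hA.isHermitian.add (hB.smul (by simp [IsSelfAdjoint]))) fun x => ?_
  have hexp : ∀ x : n → ℝ, star x ⬝ᵥ (A + ε • B) *ᵥ x =
      x ⬝ᵥ A *ᵥ x + ε * (x ⬝ᵥ B *ᵥ x) := fun x => by
    simp [Matrix.add_mulVec, Matrix.smul_mulVec]
  rcases eq_or_ne x 0 with rfl | hx
  · simp
  have hn : ‖x‖ ≠ 0 := norm_ne_zero_iff.2 hx
  have h1 := hε (‖x‖⁻¹ • x) (by simp [hS, norm_smul, hn])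
  simp only [Matrix.mulVec_smul, smul_dotProduct, dotProduct_smul, smul_eq_mul] at h1
  rw [hexp]
  have h2 : x ⬝ᵥ A *ᵥ x + ε * (x ⬝ᵥ B *ᵥ x) = ‖x‖ ^ 2 * (‖x‖⁻¹ * (‖x‖⁻¹ * x ⬝ᵥ A *ᵥ x) +
      ε * (‖x‖⁻¹ * (‖x‖⁻¹ * x ⬝ᵥ B *ᵥ x))) := by
    field_simp
  rw [h2]
  positivity

variable {V : Type*}

/-- Otherwise some functional would vanish on the span but not at y. Membership in a span thus
becomes evaluation on annihilators, which are explicit for tight stable sets. -/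
theorem exists_coeff_of_dual {ι n : Type*} [Fintype n] (s : Finset ι) (τ : ι → n → ℝ)
    {y : n → ℝ} (h : ∀ f : n → ℝ, (∀ i ∈ s, f ⬝ᵥ τ i = 0) → f ⬝ᵥ y = 0) :
    ∃ μ : ι → ℝ, y = ∑ i ∈ s, μ i • τ i := by
  classical
  by_contra hne
  have hy : y ∉ Submodule.span ℝ (τ '' (s : Set ι)) := by
    intro hy
    obtain ⟨μ, hμ⟩ := (Submodule.mem_span_image_finset_iff_exists_fun ℝ).1 hy
    refine hne ⟨fun i => if h : i ∈ s then μ ⟨i, h⟩ else 0, ?_⟩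
    rw [← hμ, ← Finset.sum_coe_sort s]
    simp
  obtain ⟨g, hg, hker⟩ := Submodule.exists_le_ker_of_notMem hy
  have hgx : ∀ z : n → ℝ, g z = (fun i => g (Pi.single i 1)) ⬝ᵥ z := by
    intro z
    rw [LinearMap.pi_apply_eq_sum_univ g z, dotProduct]
    refine Finset.sum_congr rfl fun i _ => ?_
    rw [smul_eq_mul, mul_comm]
    congr 2
    ext j
    simp [Pi.single_apply, eq_comm]
  refine hg ?_
  rw [hgx]
  refine h _ fun i hi => ?_
  rw [← hgx]
  exact hker (Submodule.subset_span ⟨i, hi, rfl⟩)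

/-- The direction `y` is feasible at the sum of the vectors `τ i`, `i ∈ s`: modulo the span of
these vectors it lies in `cone P`. The span is described by its annihilator. -/
def IsFeasibleDirection [Fintype V] (P : Set (V → ℝ)) {ι : Type*} (s : Finset ι)
    (τ : ι → Option V → ℝ) (y : Option V → ℝ) : Prop :=
  ∃ c ∈ homCone P, ∀ f : Option V → ℝ, (∀ i ∈ s, f ⬝ᵥ τ i = 0) → f ⬝ᵥ y = f ⬝ᵥ c

/-- Up to the cone vector c, the direction is a combination of the `τ i` with coefficients `μ i`;
for small ε all 1 + ε `μ i` are positive, leaving a conic combination. -/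
theorem IsFeasibleDirection.eventually_mem [Fintype V] {P : Set (V → ℝ)} (hP : Convex ℝ P)
    (hne : P.Nonempty) {ι : Type*} {s : Finset ι} {τ : ι → Option V → ℝ}
    (hτ : ∀ i ∈ s, τ i ∈ homCone P) {y : Option V → ℝ} (hy : IsFeasibleDirection P s τ y) :
    ∀ᶠ ε in 𝓝[>] (0 : ℝ), ∑ i ∈ s, τ i + ε • y ∈ homCone P := by
  obtain ⟨c, hc, hf⟩ := hy
  obtain ⟨μ, hμ⟩ := exists_coeff_of_dual s τ (y := y - c) fun f h => by
    rw [dotProduct_sub, hf f h, sub_self]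
  have hev : ∀ᶠ ε in 𝓝[>] (0 : ℝ), ∀ i ∈ s, 0 < 1 + ε * μ i := by
    rw [Filter.eventually_all_finset]
    intro i _
    have hlim : Tendsto (fun ε : ℝ => 1 + ε * μ i) (𝓝[>] 0) (𝓝 (1 + 0 * μ i)) :=
      Tendsto.mono_left (Continuous.tendsto (by fun_prop) 0) nhdsWithin_le_nhds
    exact hlim.eventually (lt_mem_nhds (by simp))
  filter_upwards [hev, self_mem_nhdsWithin] with ε hε (hε0 : 0 < ε)
  have : ∑ i ∈ s, τ i + ε • y = ∑ i ∈ s, (1 + ε * μ i) • τ i + ε • c := by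
    rw [eq_add_of_sub_eq' hμ, smul_add, Finset.smul_sum]
    simp only [add_smul, one_smul, Finset.sum_add_distrib, mul_smul]
    abel
  rw [this]
  exact homCone_add hP (homCone_sum hP hne _ _ fun i hi => homCone_smul (hτ i hi) (hε i hi).le)
    (homCone_smul hc hε0.le)

/-- The homogenized incidence vector of a vertex set. -/
def incidence [DecidableEq V] (T : Finset V) : Option V → ℝ :=
  fun a => a.elim 1 fun v => if v ∈ T then 1 else 0

theorem dotProduct_incidence [Fintype V] [DecidableEq V] (f : Option V → ℝ) (T : Finset V) :
    f ⬝ᵥ incidence T = f none + ∑ v ∈ T, f (some v) := by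
  simp [dotProduct, Fintype.sum_option, incidence]

/-- Column v of A collects the tight vectors containing v, and its complement those missing v. The
kernel of A is the common annihilator of all tight vectors. As the coordinate sum of A is ℓ times
its corner, `hgt` says exactly that the ratio exceeds ℓ once ε > 0; dividing by the corner
normalizes. -/
theorem exists_mem_LSPlus_of_perturbation [Fintype V] [DecidableEq V] {P : Set (V → ℝ)}
    (hP : Convex ℝ P) (s : Finset (Finset V)) (hsne : s.Nonempty)
    (hs : ∀ T ∈ s, incidence T ∈ homCone P) {ℓ : ℕ} (hcard : ∀ T ∈ s, T.card = ℓ)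
    (Z : Matrix (Option V) (Option V) ℝ) (hZ : Z.IsHermitian) (hZd : ∀ a, Z a none = Z a a)
    (hcol : ∀ v, IsFeasibleDirection P (s.filter (v ∈ ·)) incidence fun a => Z a (some v))
    (hcol' : ∀ v, IsFeasibleDirection P (s.filter (v ∉ ·)) incidence
      fun a => Z a none - Z a (some v))
    (hker : ∀ f : Option V → ℝ, f ≠ 0 → (∀ T ∈ s, f ⬝ᵥ incidence T = 0) → 0 < f ⬝ᵥ Z *ᵥ f)
    (hgt : ℓ * Z none none < ∑ v, Z (some v) none) :
    ∃ x ∈ LSPlus P, (ℓ : ℝ) < ∑ v, x v := by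
  have hne : P.Nonempty := by
    obtain ⟨T, hT⟩ := hsne
    obtain ⟨-, -, x, hx, -⟩ := hs T hT
    exact ⟨x, hx⟩
  set A : Matrix (Option V) (Option V) ℝ :=
    ∑ T ∈ s, Matrix.vecMulVec (incidence T) (incidence T) with hA
  have hAentry : ∀ a b, A a b = ∑ T ∈ s, incidence T a * incidence T b := fun a b => by
    simp [hA, Matrix.sum_apply, Matrix.vecMulVec_apply]
  have hAmul : ∀ f : Option V → ℝ, f ⬝ᵥ A *ᵥ f = ∑ T ∈ s, (f ⬝ᵥ incidence T) ^ 2 := fun f => by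
    simp only [hA, Matrix.sum_mulVec, dotProduct_sum, Matrix.vecMulVec_mulVec]
    refine Finset.sum_congr rfl fun T _ => ?_
    simp [dotProduct_comm (incidence T) f, sq]
  have hApsd : A.PosSemidef :=
    Matrix.posSemidef_sum s fun T _ => by
      exact Matrix.posSemidef_vecMulVec_self_star (incidence T)
  have h1 := eventually_posSemidef_add_smul hApsd hZ fun f hf h0 => hker f hf fun T hT => by
    rw [hAmul, Finset.sum_eq_zero_iff_of_nonneg fun _ _ => sq_nonneg _] at h0
    exact pow_eq_zero_iff two_ne_zero |>.1 (h0 T hT)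
  have h2 : ∀ᶠ ε in 𝓝[>] (0 : ℝ), ∀ v, (∑ T ∈ s.filter (v ∈ ·), incidence T +
      ε • fun a => Z a (some v)) ∈ homCone P :=
    Filter.eventually_all.2 fun v => (hcol v).eventually_mem hP hne fun T hT =>
      hs T (Finset.mem_filter.1 hT).1
  have h3 : ∀ᶠ ε in 𝓝[>] (0 : ℝ), ∀ v, (∑ T ∈ s.filter (v ∉ ·), incidence T +
      ε • fun a => Z a none - Z a (some v)) ∈ homCone P :=
    Filter.eventually_all.2 fun v => (hcol' v).eventually_mem hP hne fun T hT =>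
      hs T (Finset.mem_filter.1 hT).1
  have hA00 : A none none = s.card := by simp [hAentry, incidence]
  have h4 : ∀ᶠ ε in 𝓝[>] (0 : ℝ), 0 < A none none + ε * Z none none := by
    have hlim : Tendsto (fun ε : ℝ => A none none + ε * Z none none) (𝓝[>] 0)
        (𝓝 (A none none + 0 * Z none none)) :=
      Tendsto.mono_left (Continuous.tendsto (by fun_prop) 0) nhdsWithin_le_nhds
    refine hlim.eventually (lt_mem_nhds ?_)
    simpa [hA00, Finset.card_pos] using hsne
  obtain ⟨ε, h1, h2, h3, h4, hε⟩ :=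
    (h1.and (h2.and (h3.and (h4.and self_mem_nhdsWithin)))).exists
  have hε : 0 < ε := hε
  have hlift : A + ε • Z ∈ LSPlusLift P := by
    refine ⟨h1, fun a => ?_, fun v => ⟨?_, ?_⟩⟩
    · have : A a none = A a a := by
        simp only [hAentry]
        refine Finset.sum_congr rfl fun T _ => ?_
        rcases a with _ | v <;> simp [incidence]
      simp [this, hZd a]
    · convert h2 v using 1
      ext a
      simp only [Matrix.add_apply, Matrix.smul_apply, Pi.add_apply, Pi.smul_apply,
        Finset.sum_apply, hAentry, Finset.sum_filter]
      congr 1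
      refine Finset.sum_congr rfl fun T _ => ?_
      by_cases h : v ∈ T <;> simp [incidence, h]
    · convert h3 v using 1
      ext a
      simp only [Matrix.add_apply, Matrix.smul_apply, Pi.add_apply, Pi.smul_apply,
        Finset.sum_apply, hAentry, Finset.sum_filter, smul_eq_mul]
      have : ∀ p q r t : ℝ, p + ε * q - (r + ε * t) = (p - r) + ε * (q - t) := by
        intros; ring
      rw [this, ← Finset.sum_sub_distrib]
      congr 1
      refine Finset.sum_congr rfl fun T _ => ?_
      by_cases h : v ∈ T <;> simp [incidence, h]
  have hscale := LSPlusLift_smul hlift (inv_nonneg.2 h4.le)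
  refine ⟨_, ⟨_, hscale, ?_, fun v => rfl⟩, ?_⟩
  · simp only [Matrix.smul_apply, Matrix.add_apply, smul_eq_mul]
    exact inv_mul_cancel₀ h4.ne'
  · simp only [Matrix.smul_apply, Matrix.add_apply, smul_eq_mul]
    rw [← Finset.mul_sum, inv_mul_eq_div, lt_div_iff₀ h4, Finset.sum_add_distrib,
      ← Finset.mul_sum]
    have hsum : ∑ v, A (some v) none = ℓ * A none none := by
      simp only [hAentry]
      rw [Finset.sum_comm, Finset.mul_sum]
      refine Finset.sum_congr rfl fun T hT => ?_
      simp [incidence, hcard T hT]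
    rw [hsum]
    nlinarith

end Perturbation

/-! ### Stretched cliques, adding a path and contracting a path -/

section StretchedClique

/-- The edges of the stretched clique over a linear order, each listed in one orientation. The
triangle is `Fin 3`, each `i : I` is a path `(i, 1) - (i, 0) - (i, 2)`; `s` decides whether the
vertices `(i, 2)` are joined to `1 : Fin 3`. -/
def StretchedEdge (s : Prop) (I : Type*) [LinearOrder I] :
    Fin 3 ⊕ (I × Fin 3) → Fin 3 ⊕ (I × Fin 3) → Prop
  | .inl u, .inl v => u ≠ v
  | .inr (i, a), .inr (j, b) => (i = j ∧ a = 0 ∧ (b = 1 ∨ b = 2)) ∨ (i < j ∧ a = 2 ∧ b = 1)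
  | .inr (_, a), .inl v => (a = 1 ∧ (v = 1 ∨ v = 2)) ∨ (a = 2 ∧ v = 0) ∨ (a = 2 ∧ v = 1 ∧ s)
  | .inl _, .inr _ => False

/-- The stretched clique over a linear order. -/
def stretchedClique (s : Prop) (I : Type*) [LinearOrder I] :
    SimpleGraph (Fin 3 ⊕ (I × Fin 3)) :=
  SimpleGraph.fromRel (StretchedEdge s I)

variable {s : Prop} {I : Type*} [LinearOrder I]

theorem mem_fracStab_stretchedClique {x : Fin 3 ⊕ (I × Fin 3) → ℝ}
    (h01 : ∀ v, 0 ≤ x v ∧ x v ≤ 1) (h : ∀ v w, StretchedEdge s I v w → x v + x w ≤ 1) :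
    x ∈ fracStab (stretchedClique s I) := by
  refine ⟨h01, fun v w hvw => ?_⟩
  rcases ((SimpleGraph.fromRel_adj _ _ _).1 hvw).2 with h' | h'
  · exact h v w h'
  · rw [add_comm]; exact h w v h'

theorem stretchedClique_adj_inl {u v : Fin 3} :
    (stretchedClique s I).Adj (.inl u) (.inl v) ↔ u ≠ v := by
  simp [stretchedClique, StretchedEdge]
  tauto

theorem stretchedClique_adj_inr_inl {i : I} {a v : Fin 3} :
    (stretchedClique s I).Adj (.inr (i, a)) (.inl v) ↔
      (a = 1 ∧ (v = 1 ∨ v = 2)) ∨ (a = 2 ∧ v = 0) ∨ (a = 2 ∧ v = 1 ∧ s) := by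
  simp [stretchedClique, StretchedEdge]

theorem stretchedClique_adj_inr {i j : I} {a b : Fin 3} :
    (stretchedClique s I).Adj (.inr (i, a)) (.inr (j, b)) ↔
      (i = j ∧ (a = 0 ∧ (b = 1 ∨ b = 2) ∨ b = 0 ∧ (a = 1 ∨ a = 2))) ∨
      (i < j ∧ a = 2 ∧ b = 1) ∨ (j < i ∧ b = 2 ∧ a = 1) := by
  simp only [stretchedClique, StretchedEdge, SimpleGraph.fromRel_adj]
  constructor
  · rintro ⟨-, (⟨rfl, h⟩ | h) | ⟨rfl, h⟩ | h⟩ <;> tauto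
  · rintro (⟨rfl, h⟩ | ⟨hij, rfl, rfl⟩ | ⟨hij, rfl, rfl⟩)
    · refine ⟨?_, by tauto⟩
      rintro h'
      simp only [Sum.inr.injEq, Prod.mk.injEq, true_and] at h'
      subst h'
      revert h
      fin_cases a <;> simp
    · exact ⟨by simp [hij.ne], by tauto⟩
    · exact ⟨by simp [hij.ne'], by tauto⟩

theorem litValue_elim_mem_Icc {V : Type*} {x : V → ℝ} (hx : ∀ v, 0 ≤ x v ∧ x v ≤ 1)
    (l : Option V × Bool) :
    0 ≤ litValue l (fun a => a.elim 1 x) ∧ litValue l (fun a => a.elim 1 x) ≤ 1 := by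
  rcases l with ⟨_ | v, _ | _⟩
  · simp [litValue]
  · simp [litValue]
  · have := hx v
    simp only [litValue, Option.elim_none, Option.elim_some, Bool.false_eq_true, if_false]
    constructor <;> linarith
  · simpa [litValue] using hx v

section Extension

variable {j : I}

/-- Adding the path `j` with only its middle vertex chosen. -/
def addPathLit (j : I) : Fin 3 ⊕ (I × Fin 3) → Option (Fin 3 ⊕ ({i // i ≠ j} × Fin 3)) × Bool
  | .inl u => (some (.inl u), true)
  | .inr (i, a) => if h : i = j then (none, decide (a = 0)) else (some (.inr (⟨i, h⟩, a)), true)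

theorem substPoint_addPathLit_inl (x : Fin 3 ⊕ ({i // i ≠ j} × Fin 3) → ℝ) (u : Fin 3) :
    substPoint (addPathLit j) x (.inl u) = x (.inl u) := by
  simp [substPoint, addPathLit, litValue]

theorem substPoint_addPathLit_self (x : Fin 3 ⊕ ({i // i ≠ j} × Fin 3) → ℝ) (a : Fin 3) :
    substPoint (addPathLit j) x (.inr (j, a)) = if a = 0 then 1 else 0 := by
  simp [substPoint, addPathLit, litValue]

theorem substPoint_addPathLit_of_ne (x : Fin 3 ⊕ ({i // i ≠ j} × Fin 3) → ℝ) {i : I}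
    (h : i ≠ j) (a : Fin 3) :
    substPoint (addPathLit j) x (.inr (i, a)) = x (.inr (⟨i, h⟩, a)) := by
  simp [substPoint, addPathLit, litValue, h]

theorem substPoint_addPathLit_mem {x : Fin 3 ⊕ ({i // i ≠ j} × Fin 3) → ℝ}
    (hx : x ∈ fracStab (stretchedClique s {i // i ≠ j})) :
    substPoint (addPathLit j) x ∈ fracStab (stretchedClique s I) := by
  have h01 := fun v => litValue_elim_mem_Icc hx.1 (addPathLit j v)
  refine mem_fracStab_stretchedClique h01 ?_
  rintro (u | ⟨i, a⟩) (v | ⟨i', b⟩) h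
  · simp only [substPoint_addPathLit_inl]
    exact hx.2 _ _ (stretchedClique_adj_inl.2 h)
  · exact h.elim
  · by_cases hi : i = j
    · subst hi
      have ha : a ≠ 0 := by rintro rfl; simp [StretchedEdge] at h
      have := (hx.1 (.inl v)).2
      simpa only [substPoint_addPathLit_inl, substPoint_addPathLit_self, if_neg ha, zero_add]
    · simp only [substPoint_addPathLit_inl, substPoint_addPathLit_of_ne _ hi]
      exact hx.2 _ _ (stretchedClique_adj_inr_inl.2 h)
  · by_cases hi : i = j
    · by_cases hi' : i' = j
      · subst hi; subst hi'
        have : a = 0 ∧ (b = 1 ∨ b = 2) := by simpa [StretchedEdge] using h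
        obtain ⟨rfl, rfl | rfl⟩ := this <;> simp [substPoint_addPathLit_self]
      · subst hi
        have ha : a ≠ 0 := by rintro rfl; simp [StretchedEdge, Ne.symm hi'] at h
        have := (hx.1 (.inr (⟨i', hi'⟩, b))).2
        simpa only [substPoint_addPathLit_of_ne _ hi', substPoint_addPathLit_self, if_neg ha,
          zero_add]
    · by_cases hi' : i' = j
      · subst hi'
        have hb : b ≠ 0 := by rintro rfl; simp [StretchedEdge, hi] at h
        have := (hx.1 (.inr (⟨i, hi⟩, a))).2
        simpa only [substPoint_addPathLit_of_ne _ hi, substPoint_addPathLit_self, if_neg hb,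
          add_zero]
      · simp only [substPoint_addPathLit_of_ne _ hi, substPoint_addPathLit_of_ne _ hi']
        refine hx.2 _ _ (stretchedClique_adj_inr.2 ?_)
        rcases h with ⟨rfl, h⟩ | h
        · exact Or.inl ⟨rfl, Or.inl h⟩
        · exact Or.inr (Or.inl h)

theorem sum_substPoint_addPathLit [Fintype I] (x : Fin 3 ⊕ ({i // i ≠ j} × Fin 3) → ℝ) :
    ∑ v, substPoint (addPathLit j) x v = ∑ v, x v + 1 := by
  simp only [Fintype.sum_sum_type, Fintype.sum_prod_type]
  rw [Fintype.sum_eq_add_sum_subtype_ne _ j]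
  have : ∀ i : {i // i ≠ j}, ∑ a, substPoint (addPathLit j) x (.inr (i.1, a)) =
      ∑ a, x (.inr (i, a)) := fun i =>
    Finset.sum_congr rfl fun a _ => substPoint_addPathLit_of_ne x i.2 a
  simp only [this, substPoint_addPathLit_inl, substPoint_addPathLit_self]
  simp
  ring

end Extension

section Contraction

variable {j : I} {J : Type*}

/-- Contracting the path `j` to the clique vertex `ρ c` and deleting the vertex `c`. -/
def contractLit (c : Fin 3) (ρ π : Equiv.Perm (Fin 3)) (e : {i // i ≠ j} ≃ J) :
    Fin 3 ⊕ (I × Fin 3) → Option (Fin 3 ⊕ (J × Fin 3)) × Bool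
  | .inl u => if u = c then (none, false) else (some (.inl (ρ u)), true)
  | .inr (i, a) =>
      if h : i = j then (some (.inl (ρ c)), decide (a ≠ 0))
      else (some (.inr (e ⟨i, h⟩, π a)), true)

variable {c : Fin 3} {ρ π : Equiv.Perm (Fin 3)} {e : {i // i ≠ j} ≃ J}

theorem substPoint_contractLit_inl (x : Fin 3 ⊕ (J × Fin 3) → ℝ) (u : Fin 3) :
    substPoint (contractLit c ρ π e) x (.inl u) = if u = c then 0 else x (.inl (ρ u)) := by
  by_cases h : u = c <;> simp [substPoint, contractLit, litValue, h]

theorem substPoint_contractLit_self (x : Fin 3 ⊕ (J × Fin 3) → ℝ) (a : Fin 3) :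
    substPoint (contractLit c ρ π e) x (.inr (j, a)) =
      if a = 0 then 1 - x (.inl (ρ c)) else x (.inl (ρ c)) := by
  by_cases h : a = 0 <;> simp [substPoint, contractLit, litValue, h]

theorem substPoint_contractLit_of_ne (x : Fin 3 ⊕ (J × Fin 3) → ℝ) {i : I}
    (h : i ≠ j) (a : Fin 3) :
    substPoint (contractLit c ρ π e) x (.inr (i, a)) = x (.inr (e ⟨i, h⟩, π a)) := by
  simp [substPoint, contractLit, litValue, h]

/-- The value 0 at `c` disposes of its edges, and complementary values on the middle and ends of `j`
satisfy the path edges with equality. The hypotheses supply an edge of `H` for every other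
constraint. -/
theorem substPoint_contractLit_mem {H : SimpleGraph (Fin 3 ⊕ (J × Fin 3))}
    (hcl : ∀ u v, u ≠ v → H.Adj (.inl u) (.inl v))
    (hpath : ∀ i, ∀ b, b = 1 ∨ b = 2 → H.Adj (.inr (e i, π 0)) (.inr (e i, π b)))
    (hlt : ∀ i i', i < i' → H.Adj (.inr (e i, π 2)) (.inr (e i', π 1)))
    (hjlt : ∀ i, j < i.1 → H.Adj (.inl (ρ c)) (.inr (e i, π 1)))
    (hltj : ∀ i, i.1 < j → H.Adj (.inl (ρ c)) (.inr (e i, π 2)))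
    (hmix : ∀ i a v, v ≠ c → (stretchedClique s I).Adj (.inr (i.1, a)) (.inl v) →
      H.Adj (.inr (e i, π a)) (.inl (ρ v)))
    {x : Fin 3 ⊕ (J × Fin 3) → ℝ} (hx : x ∈ fracStab H) :
    substPoint (contractLit c ρ π e) x ∈ fracStab (stretchedClique s I) := by
  have h01 := fun v => litValue_elim_mem_Icc hx.1 (contractLit c ρ π e v)
  refine mem_fracStab_stretchedClique h01 ?_
  have hzero : ∀ v : Fin 3 ⊕ (I × Fin 3), substPoint (contractLit c ρ π e) x v +
      substPoint (contractLit c ρ π e) x (.inl c) ≤ 1 := by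
    intro v
    rw [substPoint_contractLit_inl, if_pos rfl, add_zero]
    exact (h01 v).2
  rintro (u | ⟨i, a⟩) (v | ⟨i', b⟩) h
  · by_cases hu : u = c
    · rw [hu, add_comm]; exact hzero _
    by_cases hv : v = c
    · rw [hv]; exact hzero _
    simp only [substPoint_contractLit_inl, if_neg hu, if_neg hv]
    exact hx.2 _ _ (hcl _ _ (ρ.injective.ne h))
  · exact h.elim
  · by_cases hv : v = c
    · rw [hv]; exact hzero _
    by_cases hi : i = j
    · subst hi
      have ha : a ≠ 0 := by rintro rfl; simp [StretchedEdge] at h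
      simp only [substPoint_contractLit_inl, substPoint_contractLit_self, if_neg ha, if_neg hv]
      exact hx.2 _ _ (hcl _ _ (ρ.injective.ne (Ne.symm hv)))
    · simp only [substPoint_contractLit_inl, substPoint_contractLit_of_ne _ hi, if_neg hv]
      exact hx.2 _ _ (hmix ⟨i, hi⟩ a v hv (stretchedClique_adj_inr_inl.2 h))
  · by_cases hi : i = j
    · by_cases hi' : i' = j
      · subst hi; subst hi'
        have : a = 0 ∧ (b = 1 ∨ b = 2) := by simpa [StretchedEdge] using h
        obtain ⟨rfl, rfl | rfl⟩ := this <;> simp [substPoint_contractLit_self]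
      · subst hi
        obtain ⟨hii, rfl, rfl⟩ : i < i' ∧ a = 2 ∧ b = 1 := by
          simpa [StretchedEdge, Ne.symm hi'] using h
        rw [substPoint_contractLit_of_ne _ hi', substPoint_contractLit_self, if_neg (by decide)]
        exact hx.2 _ _ (hjlt ⟨i', hi'⟩ hii)
    · by_cases hi' : i' = j
      · subst hi'
        obtain ⟨hii, rfl, rfl⟩ : i < i' ∧ a = 2 ∧ b = 1 := by
          simpa [StretchedEdge, hi] using h
        rw [substPoint_contractLit_of_ne _ hi, substPoint_contractLit_self, if_neg (by decide),
          add_comm]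
        exact hx.2 _ _ (hltj ⟨i, hi⟩ hii)
      · simp only [substPoint_contractLit_of_ne _ hi, substPoint_contractLit_of_ne _ hi']
        rcases h with ⟨rfl, rfl, h⟩ | ⟨h, rfl, rfl⟩
        · exact hx.2 _ _ (hpath ⟨i, hi⟩ b h)
        · exact hx.2 _ _ (hlt ⟨i, hi⟩ ⟨i', hi'⟩ h)

/-- The path contributes 1 + x (ρ c), while the deleted clique vertex loses just x (ρ c). -/
theorem sum_substPoint_contractLit [Fintype I] [Fintype J] (x : Fin 3 ⊕ (J × Fin 3) → ℝ) :
    ∑ v, substPoint (contractLit c ρ π e) x v = ∑ v, x v + 1 := by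
  simp only [Fintype.sum_sum_type, Fintype.sum_prod_type]
  rw [Fintype.sum_eq_add_sum_subtype_ne _ j]
  have h1 : ∀ i : {i // i ≠ j}, ∑ a, substPoint (contractLit c ρ π e) x (.inr (i.1, a)) =
      ∑ a, x (.inr (e i, a)) := fun i => by
    rw [← Equiv.sum_comp π fun a => x (.inr (e i, a))]
    exact Finset.sum_congr rfl fun a _ => substPoint_contractLit_of_ne x i.2 a
  have h2 : ∑ a, substPoint (contractLit c ρ π e) x (.inr (j, a)) = 1 + x (.inl (ρ c)) := by
    simp [substPoint_contractLit_self, Fin.sum_univ_three]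
  have h3 : ∑ u, substPoint (contractLit c ρ π e) x (.inl u) =
      ∑ u, x (.inl u) - x (.inl (ρ c)) := by
    rw [← Equiv.sum_comp ρ fun u => x (.inl u), ← Finset.add_sum_erase _ _ (Finset.mem_univ c),
      ← Finset.add_sum_erase _ (fun u => x (.inl (ρ u))) (Finset.mem_univ c)]
    simp only [substPoint_contractLit_inl, if_true]
    rw [Finset.sum_congr rfl fun u hu => if_neg (Finset.ne_of_mem_erase hu)]
    ring
  rw [Finset.sum_congr rfl fun i _ => h1 i, h2, h3,
    Equiv.sum_comp e fun i => ∑ a, x (.inr (i, a))]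
  ring

end Contraction

end StretchedClique

/-! ### Stable sets of maximum size -/

section TightSets

open Classical in
/-- The vertex of the path `i`, other than its middle, which is compatible with a tight stable set
that contains the clique vertex `c` or both ends of the path `c`. -/
noncomputable def tightSide (s : Prop) {I : Type*} [LinearOrder I] : Fin 3 ⊕ I → I → Fin 3
  | .inl u, _ => if u = 0 then 1 else if u = 1 ∧ s then 0 else 2
  | .inr j, i => if i < j then 1 else 2

open Classical in
/-- Membership in `tightSet`. -/
def TightMem (s : Prop) {I : Type*} [LinearOrder I] (c : Fin 3 ⊕ I) (σ : Option I) :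
    Fin 3 ⊕ (I × Fin 3) → Prop
  | .inl u => c = .inl u
  | .inr (i, a) =>
      if c = .inr i then a ≠ 0 else a = if σ = some i then tightSide s c i else 0

open Classical in
/-- The stable set that contains the clique vertex `c` or both ends of the path `c`, and the
middle vertices of the other paths, the one of `σ` being replaced by an end. -/
noncomputable def tightSet (s : Prop) {I : Type*} [LinearOrder I] [Fintype I] (c : Fin 3 ⊕ I)
    (σ : Option I) : Finset (Fin 3 ⊕ (I × Fin 3)) :=
  Finset.univ.filter (TightMem s c σ)

open Classical in
/-- The stable sets of maximum size. -/
noncomputable def tightFamily (s : Prop) (I : Type*) [LinearOrder I] [Fintype I] :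
    Finset (Finset (Fin 3 ⊕ (I × Fin 3))) :=
  Finset.univ.filter fun T =>
    (stretchedClique s I).IsIndepSet (T : Set (Fin 3 ⊕ (I × Fin 3))) ∧ T.card = Fintype.card I + 1

variable {s : Prop} {I : Type*} [LinearOrder I] [Fintype I]

theorem mem_tightSet_inl {c : Fin 3 ⊕ I} {σ : Option I} {u : Fin 3} :
    .inl u ∈ tightSet s c σ ↔ c = .inl u := by
  simp [tightSet, TightMem]

theorem mem_tightSet_inr_of_ne {c : Fin 3 ⊕ I} {σ : Option I} {i : I} {a : Fin 3}
    (h : c ≠ .inr i) :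
    .inr (i, a) ∈ tightSet s c σ ↔ a = if σ = some i then tightSide s c i else 0 := by
  simp [tightSet, TightMem, h]

theorem mem_tightSet_inr_self {σ : Option I} {i : I} {a : Fin 3} :
    .inr (i, a) ∈ tightSet s (.inr i) σ ↔ a ≠ 0 := by
  simp [tightSet, TightMem]

/-- Clique vertex 0 sees only ends 2 and clique vertex 2 only ends 1. Clique vertex 1 sees ends 1,
and under `s` also ends 2, in which case `tightSide` keeps the middle. Both ends of a path j see end
2 of the paths below j and end 1 of those above. Replacing a single middle creates no edge between
two other paths. -/
theorem stretchedEdge_not_mem_tightSet {c : Fin 3 ⊕ I} {σ : Option I}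
    {v w : Fin 3 ⊕ (I × Fin 3)} (h : StretchedEdge s I v w) (hv : v ∈ tightSet s c σ)
    (hw : w ∈ tightSet s c σ) : False := by
  rcases v with u | ⟨i, a⟩ <;> rcases w with u' | ⟨j, b⟩
  · rw [mem_tightSet_inl] at hv hw
    rw [hv] at hw
    exact h (Sum.inl_injective hw)
  · exact h
  · rw [mem_tightSet_inl] at hw
    subst hw
    rw [mem_tightSet_inr_of_ne (by simp)] at hv
    simp only [StretchedEdge] at h
    simp only [tightSide] at hv
    split_ifs at hv with h1 h2 h3
    · subst h2; simp_all
    · simp_all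
    · have : u' ≠ 0 := h2
      rcases h with ⟨rfl, h⟩ | ⟨_, rfl⟩ | ⟨_, rfl, hs⟩
      · simp at hv
      · exact h2 rfl
      · exact h3 ⟨rfl, hs⟩
    · simp_all
  · rcases h with ⟨rfl, rfl, hb⟩ | ⟨hij, rfl, rfl⟩
    · by_cases hc : c = .inr i
      · subst hc
        exact mem_tightSet_inr_self.1 hv rfl
      · rw [mem_tightSet_inr_of_ne hc] at hv hw
        rw [← hv] at hw
        subst hw
        simp at hb
    · by_cases hc : c = .inr i
      · subst hc
        rw [mem_tightSet_inr_of_ne (by simpa using hij.ne)] at hw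
        simp only [tightSide, not_lt.2 hij.le, if_false] at hw
        split_ifs at hw <;> simp at hw
      · by_cases hc' : c = .inr j
        · subst hc'
          rw [mem_tightSet_inr_of_ne hc] at hv
          simp only [tightSide, hij, if_true] at hv
          split_ifs at hv <;> simp at hv
        · rw [mem_tightSet_inr_of_ne hc] at hv
          rw [mem_tightSet_inr_of_ne hc'] at hw
          split_ifs at hv hw with h1 h2
          · rw [h1] at h2
            exact hij.ne (Option.some_injective _ h2)
          · simp at hw
          · simp at hv
          · simp at hv

theorem sum_tightSet (g : Fin 3 ⊕ (I × Fin 3) → ℝ) (c : Fin 3 ⊕ I) (σ : Option I) :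
    ∑ v ∈ tightSet s c σ, g v = (∑ u, if c = .inl u then g (.inl u) else 0) +
      ∑ i, if c = .inr i then g (.inr (i, 1)) + g (.inr (i, 2))
        else g (.inr (i, if σ = some i then tightSide s c i else 0)) := by
  classical
  rw [tightSet, Finset.sum_filter, Fintype.sum_sum_type, Fintype.sum_prod_type]
  congr 1
  · refine Finset.sum_congr rfl fun u _ => ?_
    by_cases h : c = .inl u <;> simp [TightMem, h]
  · refine Finset.sum_congr rfl fun i _ => ?_
    by_cases h : c = .inr i
    · simp [TightMem, h, Fin.sum_univ_three]
    · simp [TightMem, h]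

theorem sum_tightSet_inl (g : Fin 3 ⊕ (I × Fin 3) → ℝ) (u : Fin 3) :
    ∑ v ∈ tightSet s (.inl u) none, g v = g (.inl u) + ∑ i, g (.inr (i, (0 : Fin 3))) := by
  simp [sum_tightSet]

theorem sum_tightSet_inr (g : Fin 3 ⊕ (I × Fin 3) → ℝ) (j : I) :
    ∑ v ∈ tightSet s (.inr j) none, g v =
      g (.inr (j, 1)) + g (.inr (j, 2)) - g (.inr (j, 0)) + ∑ i, g (.inr (i, (0 : Fin 3))) := by
  rw [sum_tightSet, ← Finset.add_sum_erase _ _ (Finset.mem_univ j),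
    ← Finset.add_sum_erase _ (fun i => g (.inr (i, (0 : Fin 3)))) (Finset.mem_univ j)]
  have : ∀ i ∈ Finset.univ.erase j, (if (.inr j : Fin 3 ⊕ I) = .inr i then
      g (.inr (i, 1)) + g (.inr (i, 2)) else
      g (.inr (i, if (none : Option I) = some i then tightSide s (.inr j) i else 0))) =
      g (.inr (i, 0)) := fun i hi => by
    have := Finset.ne_of_mem_erase hi
    simp [this.symm]
  rw [Finset.sum_congr rfl this]
  simp
  ring

theorem sum_tightSet_some (g : Fin 3 ⊕ (I × Fin 3) → ℝ) {c : Fin 3 ⊕ I} {j : I}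
    (h : c ≠ .inr j) :
    ∑ v ∈ tightSet s c (some j), g v =
      ∑ v ∈ tightSet s c none, g v - g (.inr (j, 0)) + g (.inr (j, tightSide s c j)) := by
  rw [sum_tightSet, sum_tightSet, ← Finset.add_sum_erase _ _ (Finset.mem_univ j),
    ← Finset.add_sum_erase _ (fun i => if c = .inr i then g (.inr (i, 1)) + g (.inr (i, 2)) else
      g (.inr (i, if (none : Option I) = some i then tightSide s c i else 0))) (Finset.mem_univ j)]
  have : ∀ i ∈ Finset.univ.erase j, (if c = .inr i then
      g (.inr (i, 1)) + g (.inr (i, 2)) else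
      g (.inr (i, if some j = some i then tightSide s c i else 0))) =
      if c = .inr i then g (.inr (i, 1)) + g (.inr (i, 2)) else
      g (.inr (i, if (none : Option I) = some i then tightSide s c i else 0)) := fun i hi => by
    have := Finset.ne_of_mem_erase hi
    simp [this.symm]
  rw [Finset.sum_congr rfl this]
  simp [h]
  ring

theorem card_tightSet (c : Fin 3 ⊕ I) (σ : Option I) :
    (tightSet s c σ).card = Fintype.card I + 1 := by
  have h : ((tightSet s c σ).card : ℝ) = Fintype.card I + 1 := by
    rw [Finset.cast_card]
    have h0 : ∑ v ∈ tightSet s c none, (1 : ℝ) = Fintype.card I + 1 := by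
      rcases c with u | j
      · rw [sum_tightSet_inl (fun _ => 1)]
        simp [add_comm]
      · rw [sum_tightSet_inr (fun _ => 1)]
        simp [add_comm]
    rcases σ with _ | i
    · exact h0
    · by_cases hc : c = .inr i
      · subst hc
        rw [← h0, sum_tightSet (fun _ => 1), sum_tightSet (fun _ => 1)]
      · rw [sum_tightSet_some (fun _ => 1) hc, h0]
        ring
  exact_mod_cast h

theorem tightSet_mem_tightFamily (c : Fin 3 ⊕ I) (σ : Option I) :
    tightSet s c σ ∈ tightFamily s I := by
  simp only [tightFamily, Finset.mem_filter, Finset.mem_univ, true_and, card_tightSet, and_true]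
  intro v hv w hw _ hadj
  rcases ((SimpleGraph.fromRel_adj _ _ _).1 hadj).2 with h | h
  · exact stretchedEdge_not_mem_tightSet h hv hw
  · exact stretchedEdge_not_mem_tightSet h hw hv

theorem incidence_mem_homCone {V : Type*} [Finite V] [DecidableEq V] {G : SimpleGraph V} (n : ℕ)
    {T : Finset V} (hT : G.IsIndepSet (T : Set V)) :
    incidence T ∈ homCone (LSPlus^[n] (fracStab G)) := by
  refine mem_homCone_of_mem rfl (mem_iterate_LSPlus_of_zero_one ?_ ?_ n)
  · convert indicator_mem_fracStab hT using 2
    simp [incidence]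
  · intro i
    by_cases h : i ∈ T <;> simp [incidence, h]

theorem isIndepSet_of_mem_tightFamily {T : Finset (Fin 3 ⊕ (I × Fin 3))}
    (hT : T ∈ tightFamily s I) :
    (stretchedClique s I).IsIndepSet (T : Set (Fin 3 ⊕ (I × Fin 3))) := by
  simp only [tightFamily, Finset.mem_filter] at hT
  exact hT.2.1

theorem card_of_mem_tightFamily {T : Finset (Fin 3 ⊕ (I × Fin 3))}
    (hT : T ∈ tightFamily s I) : T.card = Fintype.card I + 1 := by
  simp only [tightFamily, Finset.mem_filter] at hT
  exact hT.2.2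

end TightSets

/-! ### Functionals vanishing on the tight sets that miss a vertex -/

section Annihilator

variable {s : Prop} {I : Type*} [LinearOrder I]

theorem tightSide_zero (i : I) : tightSide s (.inl 0) i = 1 := by simp [tightSide]

theorem tightSide_two (i : I) : tightSide s (.inl 2) i = 2 := by simp [tightSide]

theorem tightSide_of_lt {i j : I} (h : i < j) : tightSide s (.inr j) i = 1 := by
  simp [tightSide, h]

theorem tightSide_of_gt {i j : I} (h : j < i) : tightSide s (.inr j) i = 2 := by
  simp [tightSide, h.le]

variable [Fintype I]

theorem dotProduct_tightSet_inl (f : Option (Fin 3 ⊕ (I × Fin 3)) → ℝ) (u : Fin 3) :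
    f ⬝ᵥ incidence (tightSet s (.inl u) none) =
      f none + f (some (.inl u)) + ∑ i, f (some (.inr (i, 0))) := by
  rw [dotProduct_incidence, sum_tightSet_inl fun v => f (some v)]
  ring

theorem dotProduct_tightSet_inr (f : Option (Fin 3 ⊕ (I × Fin 3)) → ℝ) (j : I) :
    f ⬝ᵥ incidence (tightSet s (.inr j) none) =
      f none + (f (some (.inr (j, 1))) + f (some (.inr (j, 2))) - f (some (.inr (j, 0)))) +
        ∑ i, f (some (.inr (i, 0))) := by
  rw [dotProduct_incidence, sum_tightSet_inr fun v => f (some v)]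
  ring

theorem apply_tightSide_eq {f : Option (Fin 3 ⊕ (I × Fin 3)) → ℝ} {c : Fin 3 ⊕ I} {i : I}
    (h : c ≠ .inr i) (h0 : f ⬝ᵥ incidence (tightSet s c none) = 0)
    (h1 : f ⬝ᵥ incidence (tightSet s c (some i)) = 0) :
    f (some (.inr (i, tightSide s c i))) = f (some (.inr (i, 0))) := by
  rw [dotProduct_incidence] at h0 h1
  rw [sum_tightSet_some (fun v => f (some v)) h] at h1
  linarith

/-- `f` annihilates the tight sets that satisfy `Q`. -/
def AnnihilatesTight (s : Prop) (Q : Finset (Fin 3 ⊕ (I × Fin 3)) → Prop)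
    (f : Option (Fin 3 ⊕ (I × Fin 3)) → ℝ) : Prop :=
  ∀ c σ, Q (tightSet s c σ) → f ⬝ᵥ incidence (tightSet s c σ) = 0

variable {f : Option (Fin 3 ⊕ (I × Fin 3)) → ℝ}

/-- Exchanging a middle for an end in a tight set shows that f agrees on both. Clique vertex 2
allows this for all ends 2. With clique vertex 0 excluded, ends 1 are reached from the top path j,
which works for every path except j itself; hence the exceptional pair. -/
theorem annihilator_zero {j : I} (hj : ∀ i, i ≤ j)
    (hf : AnnihilatesTight s (.inl 0 ∉ ·) f) :
    ∃ e b, (∀ w, w ≠ .inl 0 → w ≠ .inr (j, 0) → w ≠ .inr (j, 2) → f (some w) = e) ∧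
      f (some (.inr (j, 0))) = b ∧ f (some (.inr (j, 2))) = b := by
  have h1 := hf (.inl 1) none (by simp [mem_tightSet_inl])
  have h2 := hf (.inl 2) none (by simp [mem_tightSet_inl])
  have h02 : ∀ i, f (some (.inr (i, 2))) = f (some (.inr (i, 0))) := fun i => by
    have := apply_tightSide_eq (by simp) h2 (hf (.inl 2) (some i) (by simp [mem_tightSet_inl]))
    rwa [tightSide_two] at this
  have hr : ∀ i, f ⬝ᵥ incidence (tightSet s (.inr i) none) = 0 := fun i =>
    hf (.inr i) none (by simp [mem_tightSet_inl])
  have h01 : ∀ i, i ≠ j → f (some (.inr (i, 1))) = f (some (.inr (i, 0))) := fun i hi => by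
    have := apply_tightSide_eq (by simpa using Ne.symm hi) (hr j)
      (hf (.inr j) (some i) (by simp [mem_tightSet_inl]))
    rwa [tightSide_of_lt (lt_of_le_of_ne (hj i) hi)] at this
  simp only [dotProduct_tightSet_inl, dotProduct_tightSet_inr] at h1 h2 hr
  refine ⟨f (some (.inl 2)), f (some (.inr (j, 0))), ?_, rfl, h02 j⟩
  rintro (u | ⟨i, a⟩) hw0 hw1 hw2
  · fin_cases u
    · simp at hw0
    · simp only [Fin.mk_one]; linarith
    · rfl
  · have g1 := hr i
    have g2 := h02 i
    by_cases hi : i = j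
    · subst hi
      fin_cases a
      · simp at hw1
      · simp only [Fin.mk_one]; linarith
      · simp at hw2
    · have g3 := h01 i hi
      fin_cases a <;> simp only [Fin.mk_one, Fin.zero_eta, Fin.reduceFinMk] <;> linarith

/-- Clique vertices 0 and 2 remain available and reach both ends of every path, so no exceptional
pair arises. -/
theorem annihilator_one (hf : AnnihilatesTight s (.inl 1 ∉ ·) f) :
    ∃ e, ∀ w, w ≠ .inl 1 → f (some w) = e := by
  have h1 := hf (.inl 0) none (by simp [mem_tightSet_inl])
  have h2 := hf (.inl 2) none (by simp [mem_tightSet_inl])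
  have h02 : ∀ i, f (some (.inr (i, 2))) = f (some (.inr (i, 0))) := fun i => by
    have := apply_tightSide_eq (by simp) h2 (hf (.inl 2) (some i) (by simp [mem_tightSet_inl]))
    rwa [tightSide_two] at this
  have h01 : ∀ i, f (some (.inr (i, 1))) = f (some (.inr (i, 0))) := fun i => by
    have := apply_tightSide_eq (by simp) h1 (hf (.inl 0) (some i) (by simp [mem_tightSet_inl]))
    rwa [tightSide_zero] at this
  have hr : ∀ i, f ⬝ᵥ incidence (tightSet s (.inr i) none) = 0 := fun i =>
    hf (.inr i) none (by simp [mem_tightSet_inl])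
  simp only [dotProduct_tightSet_inl, dotProduct_tightSet_inr] at h1 h2 hr
  refine ⟨f (some (.inl 2)), ?_⟩
  rintro (u | ⟨i, a⟩) hw0
  · fin_cases u
    · simp only [Fin.zero_eta]; linarith
    · simp at hw0
    · rfl
  · have g1 := hr i
    have g2 := h02 i
    have g3 := h01 i
    fin_cases a <;> simp only [Fin.mk_one, Fin.zero_eta, Fin.reduceFinMk] <;> linarith

/-- Mirror image of `annihilator_zero`: ends 2 are now reached from the bottom path. -/
theorem annihilator_two {j : I} (hj : ∀ i, j ≤ i)
    (hf : AnnihilatesTight s (.inl 2 ∉ ·) f) :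
    ∃ e b, (∀ w, w ≠ .inl 2 → w ≠ .inr (j, 0) → w ≠ .inr (j, 1) → f (some w) = e) ∧
      f (some (.inr (j, 0))) = b ∧ f (some (.inr (j, 1))) = b := by
  have h1 := hf (.inl 0) none (by simp [mem_tightSet_inl])
  have h2 := hf (.inl 1) none (by simp [mem_tightSet_inl])
  have h01 : ∀ i, f (some (.inr (i, 1))) = f (some (.inr (i, 0))) := fun i => by
    have := apply_tightSide_eq (by simp) h1 (hf (.inl 0) (some i) (by simp [mem_tightSet_inl]))
    rwa [tightSide_zero] at this
  have hr : ∀ i, f ⬝ᵥ incidence (tightSet s (.inr i) none) = 0 := fun i =>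
    hf (.inr i) none (by simp [mem_tightSet_inl])
  have h02 : ∀ i, i ≠ j → f (some (.inr (i, 2))) = f (some (.inr (i, 0))) := fun i hi => by
    have := apply_tightSide_eq (by simpa using Ne.symm hi) (hr j)
      (hf (.inr j) (some i) (by simp [mem_tightSet_inl]))
    rwa [tightSide_of_gt (lt_of_le_of_ne (hj i) (Ne.symm hi))] at this
  simp only [dotProduct_tightSet_inl, dotProduct_tightSet_inr] at h1 h2 hr
  refine ⟨f (some (.inl 0)), f (some (.inr (j, 0))), ?_, rfl, h01 j⟩
  rintro (u | ⟨i, a⟩) hw0 hw1 hw2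
  · fin_cases u
    · rfl
    · simp only [Fin.mk_one]; linarith
    · simp at hw0
  · have g1 := hr i
    have g2 := h01 i
    by_cases hi : i = j
    · subst hi
      fin_cases a
      · simp at hw1
      · simp at hw2
      · simp only [Fin.reduceFinMk]; linarith
    · have g3 := h02 i hi
      fin_cases a <;> simp only [Fin.mk_one, Fin.zero_eta, Fin.reduceFinMk] <;> linarith

/-- The tight sets through the middle of `j` already contain all exchanges on the other paths, so
they force a common value away from `j`. -/
theorem annihilator_path {j : I} {Q : Finset (Fin 3 ⊕ (I × Fin 3)) → Prop}
    (hQ : ∀ c σ, c ≠ .inr j → σ ≠ some j → Q (tightSet s c σ)) (hf : AnnihilatesTight s Q f) :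
    ∀ w, (∀ a, w ≠ .inr (j, a)) → f (some w) = f (some (.inl 0)) := by
  have h0 := hf (.inl 0) none (hQ _ _ (by simp) (by simp))
  have h1 := hf (.inl 1) none (hQ _ _ (by simp) (by simp))
  have h2 := hf (.inl 2) none (hQ _ _ (by simp) (by simp))
  have h02 : ∀ i, i ≠ j → f (some (.inr (i, 2))) = f (some (.inr (i, 0))) := fun i hi => by
    have := apply_tightSide_eq (by simp) h2
      (hf (.inl 2) (some i) (hQ _ _ (by simp) (by simpa using hi)))
    rwa [tightSide_two] at this
  have h01 : ∀ i, i ≠ j → f (some (.inr (i, 1))) = f (some (.inr (i, 0))) := fun i hi => by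
    have := apply_tightSide_eq (by simp) h0
      (hf (.inl 0) (some i) (hQ _ _ (by simp) (by simpa using hi)))
    rwa [tightSide_zero] at this
  have hr : ∀ i, i ≠ j → f ⬝ᵥ incidence (tightSet s (.inr i) none) = 0 := fun i hi =>
    hf (.inr i) none (hQ _ _ (by simpa using hi) (by simp))
  simp only [dotProduct_tightSet_inl, dotProduct_tightSet_inr] at h0 h1 h2 hr
  rintro (u | ⟨i, a⟩) hw
  · fin_cases u <;> simp only [Fin.mk_one, Fin.zero_eta, Fin.reduceFinMk] <;> linarith
  · have hi : i ≠ j := fun h => hw a (by rw [h])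
    have g1 := hr i hi
    have g2 := h02 i hi
    have g3 := h01 i hi
    fin_cases a <;> simp only [Fin.mk_one, Fin.zero_eta, Fin.reduceFinMk] <;> linarith

theorem annihilator_end_one {j : I} (hf : AnnihilatesTight s (.inr (j, 1) ∉ ·) f) :
    ∃ e b, (∀ w, w ≠ .inr (j, 1) → w ≠ .inr (j, 0) → w ≠ .inr (j, 2) → f (some w) = e) ∧
      f (some (.inr (j, 0))) = b ∧ f (some (.inr (j, 2))) = b := by
  refine ⟨_, _, fun w h1 h0 h2 => annihilator_path (j := j) ?_ hf w ?_, rfl, ?_⟩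
  · intro c σ hc hσ
    rw [mem_tightSet_inr_of_ne hc, if_neg hσ]
    simp
  · intro a
    fin_cases a
    · exact h0
    · exact h1
    · exact h2
  · have := apply_tightSide_eq (by simp)
      (hf (.inl 2) none (by simp [mem_tightSet_inr_of_ne]))
      (hf (.inl 2) (some j) (by simp [mem_tightSet_inr_of_ne, tightSide_two]))
    rwa [tightSide_two] at this

theorem annihilator_end_two {j : I} (hf : AnnihilatesTight s (.inr (j, 2) ∉ ·) f) :
    ∃ e b, (∀ w, w ≠ .inr (j, 2) → w ≠ .inr (j, 0) → w ≠ .inr (j, 1) → f (some w) = e) ∧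
      f (some (.inr (j, 0))) = b ∧ f (some (.inr (j, 1))) = b := by
  refine ⟨_, _, fun w h1 h0 h2 => annihilator_path (j := j) ?_ hf w ?_, rfl, ?_⟩
  · intro c σ hc hσ
    rw [mem_tightSet_inr_of_ne hc, if_neg hσ]
    simp
  · intro a
    fin_cases a
    · exact h0
    · exact h2
    · exact h1
  · have := apply_tightSide_eq (by simp)
      (hf (.inl 0) none (by simp [mem_tightSet_inr_of_ne]))
      (hf (.inl 0) (some j) (by simp [mem_tightSet_inr_of_ne, tightSide_zero]))
    rwa [tightSide_zero] at this

end Annihilator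

/-! ### The perturbation and its feasible directions -/

section Directions

variable {s : Prop} {I : Type*} [Fintype I]

/-- The indicator of the middle vertices of the paths. -/
def midIndicator : Fin 3 ⊕ (I × Fin 3) → ℝ
  | .inl _ => 0
  | .inr (_, a) => if a = 0 then 1 else 0

theorem sum_mul_midIndicator (g : Fin 3 ⊕ (I × Fin 3) → ℝ) :
    ∑ v, g v * midIndicator v = ∑ i, g (.inr (i, 0)) := by
  simp [Fintype.sum_sum_type, Fintype.sum_prod_type, midIndicator]

theorem sum_midIndicator :
    ∑ v : Fin 3 ⊕ (I × Fin 3), midIndicator v = (Fintype.card I : ℝ) := by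
  have := sum_mul_midIndicator (I := I) fun _ => 1
  simpa using this

variable [LinearOrder I]

variable (I) in
/-- The direction in which the sum of the tight rank-one matrices is perturbed. -/
def perturbationMatrix :
    Matrix (Option (Fin 3 ⊕ (I × Fin 3))) (Option (Fin 3 ⊕ (I × Fin 3))) ℝ
  | none, none => -(Fintype.card I + 1)
  | none, some v => -(Fintype.card I + 2) * midIndicator v
  | some v, none => -(Fintype.card I + 2) * midIndicator v
  | some v, some w => if v = w then -(Fintype.card I + 2) * midIndicator v else 0

theorem dotProduct_perturbationMatrix_none (f : Option (Fin 3 ⊕ (I × Fin 3)) → ℝ) :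
    f ⬝ᵥ (fun a => perturbationMatrix I a none) =
      -(Fintype.card I + 1) * f none -
        (Fintype.card I + 2) * ∑ i, f (some (.inr (i, 0))) := by
  rw [← sum_mul_midIndicator fun v => f (some v), Finset.mul_sum]
  simp only [dotProduct, Fintype.sum_option, perturbationMatrix]
  rw [sub_eq_add_neg, ← Finset.sum_neg_distrib]
  congr 1
  · ring
  · exact Finset.sum_congr rfl fun v _ => by ring

theorem dotProduct_perturbationMatrix_some (f : Option (Fin 3 ⊕ (I × Fin 3)) → ℝ)
    (v : Fin 3 ⊕ (I × Fin 3)) :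
    f ⬝ᵥ (fun a => perturbationMatrix I a (some v)) =
      -(Fintype.card I + 2) * midIndicator v * (f none + f (some v)) := by
  simp only [dotProduct, Fintype.sum_option, perturbationMatrix]
  simp
  ring

theorem perturbationMatrix_isHermitian : (perturbationMatrix I).IsHermitian := by
  ext a b
  rcases a with _ | v <;> rcases b with _ | w <;> simp [perturbationMatrix, eq_comm]
  split_ifs with h
  · rw [h]
  · rfl

theorem annihilatesTight_of_filter {Q : Finset (Fin 3 ⊕ (I × Fin 3)) → Prop} [DecidablePred Q]
    {f : Option (Fin 3 ⊕ (I × Fin 3)) → ℝ}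
    (hf : ∀ T ∈ (tightFamily s I).filter Q, f ⬝ᵥ incidence T = 0) : AnnihilatesTight s Q f :=
  fun c σ h => hf _ (Finset.mem_filter.2 ⟨tightSet_mem_tightFamily c σ, h⟩)

theorem sum_mul_of_classes {V : Type*} [Fintype V] [DecidableEq V] {f g : V → ℝ} {v p q : V}
    {e b : ℝ} (hpq : p ≠ q) (hv : g v = 0) (he : ∀ w, w ≠ v → w ≠ p → w ≠ q → f w = e)
    (hp : f p = b) (hq : f q = b) :
    ∑ w, f w * g w = e * ∑ w, g w + (b - e) * (g p + g q) := by
  have hpt : ∀ w, f w * g w = e * g w + ((if w = p then (b - e) * g p else 0) +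
      if w = q then (b - e) * g q else 0) := by
    intro w
    by_cases h1 : w = p
    · subst h1; rw [hp, if_pos rfl, if_neg hpq]; ring
    · by_cases h2 : w = q
      · subst h2; rw [hq, if_pos rfl, if_neg h1]; ring
      · rw [if_neg h1, if_neg h2]
        by_cases h3 : w = v
        · subst h3; rw [hv]; ring
        · rw [he w h3 h1 h2]; ring
  rw [Finset.sum_congr rfl fun w _ => hpt w, Finset.sum_add_distrib, Finset.sum_add_distrib,
    Finset.mul_sum]
  simp
  ring

variable {n : ℕ}

theorem dotProduct_elim {V : Type*} [Fintype V] (f : Option V → ℝ) (x : V → ℝ) :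
    (f ⬝ᵥ fun a => a.elim 1 x) = f none + ∑ v, f (some v) * x v := by
  simp [dotProduct, Fintype.sum_option]

/-- An annihilator is governed by the two values e and b. Tight vectors missing v, of the kind of T,
and (1, x) all give the pair p, q total weight 1, so b cancels at (1, x) and only e times the excess
of x survives. -/
theorem isFeasibleDirection_of_classes {v p q : Fin 3 ⊕ (I × Fin 3)}
    (hmid : midIndicator v = 0) (hpq : p ≠ q) (hmpq : midIndicator p + midIndicator q = 1)
    (hf : ∀ f : Option (Fin 3 ⊕ (I × Fin 3)) → ℝ, AnnihilatesTight s (v ∉ ·) f →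
      ∃ e b, (∀ w, w ≠ v → w ≠ p → w ≠ q → f (some w) = e) ∧ f (some p) = b ∧ f (some q) = b)
    {c : Fin 3 ⊕ I} {σ : Option I} (hvT : v ∉ tightSet s c σ) (hpT : p ∈ tightSet s c σ)
    (hqT : q ∉ tightSet s c σ) {x : Fin 3 ⊕ (I × Fin 3) → ℝ}
    (hx : x ∈ LSPlus^[n] (fracStab (stretchedClique s I))) (hxv : x v = 0)
    (hxpq : x p + x q = 1) (hsum : (Fintype.card I + 1 : ℝ) < ∑ w, x w) :
    IsFeasibleDirection (LSPlus^[n] (fracStab (stretchedClique s I)))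
      ((tightFamily s I).filter (v ∉ ·)) incidence
      (fun a => perturbationMatrix I a none - perturbationMatrix I a (some v)) := by
  set ρ := ∑ w, x w - (Fintype.card I + 1) with hρ
  have hρ0 : 0 < ρ := by linarith
  set T := tightSet s c σ with hT
  have hxc : (fun a : Option _ => a.elim 1 x) ∈
      homCone (LSPlus^[n] (fracStab (stretchedClique s I))) :=
    mem_homCone_of_mem rfl hx
  have hTc : incidence (T.erase p) ∈ homCone (LSPlus^[n] (fracStab (stretchedClique s I))) :=
    incidence_mem_homCone n ((isIndepSet_of_mem_tightFamily (tightSet_mem_tightFamily c σ)).mono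
      (Finset.coe_subset.2 (Finset.erase_subset _ _)))
  -- On an annihilator (1, x) takes the value e ρ, T without p takes -b, and the direction takes 2 e
  -- - b; this fixes both coefficients.
  refine ⟨(2 / ρ) • (fun a : Option _ => a.elim 1 x) + incidence (T.erase p),
    homCone_add (convex_iterate_LSPlus (convex_fracStab _) n)
      (homCone_smul hxc (by positivity)) hTc, fun f hfT => ?_⟩
  have hann := annihilatesTight_of_filter hfT
  obtain ⟨e, b, he, hp, hq⟩ := hf f hann
  have h1 := hann c σ hvT
  rw [← hT, dotProduct_incidence] at h1
  have h2 : ∑ w ∈ T, f (some w) = e * (Fintype.card I + 1) + (b - e) := by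
    have := sum_mul_of_classes (g := fun w => if w ∈ T then (1 : ℝ) else 0) hpq (by simp [hvT])
      he hp hq
    simp only [mul_ite, mul_one, mul_zero, Finset.sum_ite_mem, Finset.univ_inter, hpT, hqT,
      if_true, if_false, add_zero, Finset.sum_const, nsmul_eq_mul] at this
    rw [this, hT, card_tightSet]
    push_cast
    ring
  have h3 : ∑ i, f (some (.inr (i, 0))) = e * Fintype.card I + (b - e) := by
    rw [← sum_mul_midIndicator fun w => f (some w), sum_mul_of_classes hpq hmid he hp hq,
      sum_midIndicator, hmpq, mul_one]
  have h4 : ∑ w, f (some w) * x w = e * (ρ + (Fintype.card I + 1)) + (b - e) := by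
    rw [sum_mul_of_classes hpq hxv he hp hq, hxpq, hρ]
    ring
  have h5 := Finset.add_sum_erase T (fun w => f (some w)) hpT
  have hy : (fun a => perturbationMatrix I a none - perturbationMatrix I a (some v)) =
    (fun a => perturbationMatrix I a none) - fun a => perturbationMatrix I a (some v) := rfl
  rw [hy, dotProduct_sub, dotProduct_perturbationMatrix_none, dotProduct_perturbationMatrix_some,
    hmid, h3, dotProduct_add, dotProduct_smul, dotProduct_elim, dotProduct_incidence, h4,
    smul_eq_mul]
  have h0 : f none = -(e * (Fintype.card I + 1) + (b - e)) := by linarith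
  have h6 : ∑ w ∈ T.erase p, f (some w) = e * (Fintype.card I + 1) + (b - e) - b := by
    linarith
  rw [h6, h0]
  field_simp
  ring

theorem isFeasibleDirection_mid {j : I} {x : Fin 3 ⊕ (I × Fin 3) → ℝ}
    (hx : x ∈ LSPlus^[n] (fracStab (stretchedClique s I)))
    (hxj : ∀ a, x (.inr (j, a)) = if a = 0 then 1 else 0)
    (hsum : (Fintype.card I + 1 : ℝ) < ∑ w, x w) :
    IsFeasibleDirection (LSPlus^[n] (fracStab (stretchedClique s I)))
      ((tightFamily s I).filter (.inr (j, 0) ∈ ·)) incidence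
      (fun a => perturbationMatrix I a (some (.inr (j, 0)))) := by
  set ρ := ∑ w, x w - (Fintype.card I + 1) with hρ
  have hρ0 : 0 < ρ := by linarith
  have hxc : (fun a : Option _ => a.elim 1 x) ∈
      homCone (LSPlus^[n] (fracStab (stretchedClique s I))) :=
    mem_homCone_of_mem rfl hx
  -- With d = `Fintype.card I`, the direction evaluates to (d + 2) d e and (1, x) to ρ e.
  refine ⟨((Fintype.card I + 2) * Fintype.card I / ρ) • (fun a : Option _ => a.elim 1 x),
      homCone_smul hxc (by positivity), fun f hfT => ?_⟩
  have hann := annihilatesTight_of_filter hfT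
  have hQ : ∀ (c : Fin 3 ⊕ I) (σ : Option I), c ≠ .inr j → σ ≠ some j →
      .inr (j, 0) ∈ tightSet s c σ := fun c σ hc hσ => by
    rw [mem_tightSet_inr_of_ne hc, if_neg hσ]
  have hpath := annihilator_path hQ hann
  set e := f (some (.inl 0)) with he
  have h0 := hann (.inl 0) none (hQ _ _ (by simp) (by simp))
  rw [dotProduct_tightSet_inl] at h0
  have h3 : ∑ i, f (some (.inr (i, 0))) =
      f (some (.inr (j, 0))) + (Fintype.card I - 1) * e := by
    rw [← Finset.add_sum_erase _ _ (Finset.mem_univ j)]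
    congr 1
    rw [Finset.sum_congr rfl fun i hi => hpath (.inr (i, 0)) fun a h => by
      simp only [Sum.inr.injEq, Prod.mk.injEq] at h
      exact Finset.ne_of_mem_erase hi h.1]
    rw [Finset.sum_const, Finset.card_erase_of_mem (Finset.mem_univ j), nsmul_eq_mul,
      Finset.card_univ, Nat.cast_sub (Fintype.card_pos_iff.2 ⟨j⟩)]
    simp
  have h4 : ∑ w, f (some w) * x w = f (some (.inr (j, 0))) + e * (∑ w, x w - 1) := by
    have hpt : ∀ w, f (some w) * x w = e * x w +
        if w = .inr (j, 0) then f (some (.inr (j, 0))) - e else 0 := by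
      intro w
      by_cases hw : ∃ a, w = .inr (j, a)
      · obtain ⟨a, rfl⟩ := hw
        by_cases ha : a = 0
        · subst ha; simp [hxj]
        · simp [hxj, ha]
      · push Not at hw
        rw [hpath w hw, if_neg (hw 0), add_zero]
    rw [Finset.sum_congr rfl fun w _ => hpt w, Finset.sum_add_distrib, ← Finset.mul_sum]
    simp
    ring
  rw [dotProduct_perturbationMatrix_some, dotProduct_smul, dotProduct_elim, h4, smul_eq_mul]
  have hm : midIndicator (Sum.inr (j, 0) : Fin 3 ⊕ (I × Fin 3)) = 1 := by simp [midIndicator]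
  have hn : f none = -e - (f (some (.inr (j, 0))) + (Fintype.card I - 1) * e) := by linarith
  have hs' : ∑ w, x w = ρ + (Fintype.card I + 1) := by rw [hρ]; ring
  rw [hm, hn, hs']
  field_simp
  ring

theorem isFeasibleDirection_mid_compl (j : I) :
    IsFeasibleDirection (LSPlus^[n] (fracStab (stretchedClique s I)))
      ((tightFamily s I).filter (.inr (j, 0) ∉ ·)) incidence
      (fun a => perturbationMatrix I a none - perturbationMatrix I a (some (.inr (j, 0)))) := by
  set T := tightSet s (.inr j : Fin 3 ⊕ I) none with hT
  set ω : Fin 3 ⊕ (I × Fin 3) → ℝ := fun w => 1 + (Fintype.card I + 2) * midIndicator w with hω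
  have hmid0 : ∀ w : Fin 3 ⊕ (I × Fin 3), 0 ≤ midIndicator w := by
    rintro (u | ⟨i, a⟩)
    · exact le_rfl
    · simp only [midIndicator]; split_ifs <;> norm_num
  have hTi := isIndepSet_of_mem_tightFamily (tightSet_mem_tightFamily (s := s) (.inr j) none)
  have hTc : ∀ w, incidence (T.erase w) ∈
      homCone (LSPlus^[n] (fracStab (stretchedClique s I))) := fun w =>
    incidence_mem_homCone n (hTi.mono (Finset.coe_subset.2 (Finset.erase_subset _ _)))
  have hconv := convex_iterate_LSPlus (convex_fracStab (stretchedClique s I)) n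
  have hne : (LSPlus^[n] (fracStab (stretchedClique s I))).Nonempty := by
    obtain ⟨-, -, x, hx, -⟩ := hTc (.inl 0)
    exact ⟨x, hx⟩
  -- Removing w from the tight set T gives the value -f(w). The direction evaluates to minus the sum
  -- of f over T with weight 1 at the ends of j and d + 3 at the middles, which are the weights ω.
  refine ⟨∑ w ∈ T, ω w • incidence (T.erase w), homCone_sum hconv hne _ _ fun w _ =>
    homCone_smul (hTc w) ?_, fun f hfT => ?_⟩
  · have := hmid0 w
    positivity
  have h1 := annihilatesTight_of_filter hfT (.inr j) none (by simp [mem_tightSet_inr_self])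
  rw [← hT] at h1
  have h2 : f ⬝ᵥ ∑ w ∈ T, ω w • incidence (T.erase w) = ∑ w ∈ T, -(ω w * f (some w)) := by
    rw [dotProduct_sum]
    refine Finset.sum_congr rfl fun w hw => ?_
    rw [dotProduct_smul, smul_eq_mul, dotProduct_incidence]
    rw [dotProduct_incidence, ← Finset.add_sum_erase T (fun w => f (some w)) hw] at h1
    have : f none + ∑ v ∈ T.erase w, f (some v) = - f (some w) := by linarith
    rw [this]
    ring
  have hy : (fun a => perturbationMatrix I a none - perturbationMatrix I a (some (.inr (j, 0)))) =
    (fun a => perturbationMatrix I a none) -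
      fun a => perturbationMatrix I a (some (.inr (j, 0))) := rfl
  rw [hy, dotProduct_sub, dotProduct_perturbationMatrix_none, dotProduct_perturbationMatrix_some,
    h2, hT, sum_tightSet_inr fun w => -(ω w * f (some w))]
  rw [hT, dotProduct_tightSet_inr] at h1
  have h3 : ∑ i : I, -(ω (.inr (i, 0)) * f (some (.inr (i, 0)))) =
      -(Fintype.card I + 3) * ∑ i, f (some (.inr (i, 0))) := by
    rw [Finset.mul_sum]
    refine Finset.sum_congr rfl fun i _ => ?_
    simp [hω, midIndicator]
    ring
  rw [h3]
  simp only [hω, midIndicator]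
  simp
  linear_combination h1

end Directions

/-! ### Points beyond the stability number -/

section LowerBound

variable {s : Prop} {I : Type} [LinearOrder I] {n : ℕ}

/-- Once clique vertex 0 is deleted, the contracted top path is joined to the other two clique
vertices and to all ends 2, just as vertex 0 was. -/
theorem contractLit_max_mem {j : I} (hj : ∀ i, i ≤ j)
    {x : Fin 3 ⊕ ({i // i ≠ j} × Fin 3) → ℝ}
    (hx : x ∈ fracStab (stretchedClique s {i // i ≠ j})) :
    substPoint (contractLit 0 (Equiv.refl _) (Equiv.refl _) (Equiv.refl {i // i ≠ j})) x ∈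
      fracStab (stretchedClique s I) := by
  refine substPoint_contractLit_mem ?_ ?_ ?_ ?_ ?_ ?_ hx
  · intro u v h
    exact stretchedClique_adj_inl.2 h
  · intro i b hb
    exact stretchedClique_adj_inr.2 (by simp [hb])
  · intro i i' h
    exact stretchedClique_adj_inr.2 (Or.inr (Or.inl ⟨h, rfl, rfl⟩))
  · intro i h
    exact absurd h (not_lt.2 (hj _))
  · intro i _
    exact (stretchedClique_adj_inr_inl.2 (by simp)).symm
  · intro i a v _ h
    exact stretchedClique_adj_inr_inl.2 (stretchedClique_adj_inr_inl.1 h)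

/-- Likewise the contracted bottom path is joined to all ends 1 and takes the place of clique vertex
2. -/
theorem contractLit_min_mem {j : I} (hj : ∀ i, j ≤ i)
    {x : Fin 3 ⊕ ({i // i ≠ j} × Fin 3) → ℝ}
    (hx : x ∈ fracStab (stretchedClique s {i // i ≠ j})) :
    substPoint (contractLit 2 (Equiv.refl _) (Equiv.refl _) (Equiv.refl {i // i ≠ j})) x ∈
      fracStab (stretchedClique s I) := by
  refine substPoint_contractLit_mem ?_ ?_ ?_ ?_ ?_ ?_ hx
  · intro u v h
    exact stretchedClique_adj_inl.2 h
  · intro i b hb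
    exact stretchedClique_adj_inr.2 (by simp [hb])
  · intro i i' h
    exact stretchedClique_adj_inr.2 (Or.inr (Or.inl ⟨h, rfl, rfl⟩))
  · intro i _
    exact (stretchedClique_adj_inr_inl.2 (by simp)).symm
  · intro i h
    exact absurd h (not_lt.2 (hj _))
  · intro i a v _ h
    exact stretchedClique_adj_inr_inl.2 (stretchedClique_adj_inr_inl.1 h)

/-- With clique vertex 1 deleted, the contracted top path and vertex 0 see ends 2, and vertex 2 sees
ends 1. Swapping the two ends and reversing the order turns this into a stretched clique again. The
edges governed by `s` all met vertex 1, so the parameter becomes `False`. -/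
theorem contractLit_dual_one_mem {j : I} (hj : ∀ i, i ≤ j)
    {x : Fin 3 ⊕ ({i // i ≠ j}ᵒᵈ × Fin 3) → ℝ}
    (hx : x ∈ fracStab (stretchedClique False {i // i ≠ j}ᵒᵈ)) :
    substPoint (contractLit 1 (finRotate 3) (Equiv.swap 1 2) OrderDual.toDual) x ∈
      fracStab (stretchedClique s I) := by
  refine substPoint_contractLit_mem ?_ ?_ ?_ ?_ ?_ ?_ hx
  · intro u v h
    exact stretchedClique_adj_inl.2 h
  · rintro i b (rfl | rfl)
    · exact stretchedClique_adj_inr.2 (Or.inl ⟨rfl, by decide⟩)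
    · exact stretchedClique_adj_inr.2 (Or.inl ⟨rfl, by decide⟩)
  · intro i i' h
    exact stretchedClique_adj_inr.2 (Or.inr (Or.inr ⟨h, by decide, by decide⟩))
  · intro i h
    exact absurd h (not_lt.2 (hj _))
  · intro i _
    exact (stretchedClique_adj_inr_inl.2 (by decide)).symm
  · intro i a v hv h
    rcases stretchedClique_adj_inr_inl.1 h with ⟨rfl, rfl | rfl⟩ | ⟨rfl, rfl⟩ | ⟨rfl, rfl, -⟩
    · exact absurd rfl hv
    · exact stretchedClique_adj_inr_inl.2 (by decide)
    · exact stretchedClique_adj_inr_inl.2 (by decide)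
    · exact absurd rfl hv

variable [Fintype I]

theorem annihilator_univ [Nonempty I] {f : Option (Fin 3 ⊕ (I × Fin 3)) → ℝ}
    (hf : AnnihilatesTight s (fun _ => True) f) :
    ∃ e, (∀ w, f (some w) = e) ∧ f none = -(Fintype.card I + 1) * e := by
  obtain ⟨e, he⟩ := annihilator_one (s := s) fun c σ _ => hf c σ trivial
  have h0 := hf (.inl 0) none trivial
  have h1 := hf (.inl 1) none trivial
  rw [dotProduct_tightSet_inl] at h0 h1
  have h2 := he (.inl 0) (by simp)
  refine ⟨e, fun w => ?_, ?_⟩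
  · by_cases hw : w = .inl 1
    · subst hw; linarith
    · exact he w hw
  · rw [Finset.sum_congr rfl fun i _ => he (.inr (i, 0)) (by simp), h2] at h0
    simp at h0
    linarith

theorem dotProduct_perturbationMatrix_mulVec_pos [Nonempty I]
    {f : Option (Fin 3 ⊕ (I × Fin 3)) → ℝ} (hf0 : f ≠ 0)
    (hf : AnnihilatesTight s (fun _ => True) f) : 0 < f ⬝ᵥ perturbationMatrix I *ᵥ f := by
  obtain ⟨e, he, hn⟩ := annihilator_univ hf
  have he0 : e ≠ 0 := by
    rintro rfl
    refine hf0 (funext fun a => ?_)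
    rcases a with _ | w
    · simpa using hn
    · exact he w
  have hsymm : ∀ a b, perturbationMatrix I a b = perturbationMatrix I b a := fun a b => by
    simpa using (perturbationMatrix_isHermitian (I := I)).apply b a
  have h1 : ∀ a, (perturbationMatrix I *ᵥ f) a = f ⬝ᵥ fun b => perturbationMatrix I b a :=
    fun a => by
      rw [Matrix.mulVec, dotProduct_comm]
      congr 1
      ext b
      exact hsymm a b
  have h2 : ∀ w : Fin 3 ⊕ (I × Fin 3), f (some w) * (perturbationMatrix I *ᵥ f) (some w) =
      ((Fintype.card I + 2) * Fintype.card I * e ^ 2) * midIndicator w := fun w => by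
    rw [h1, dotProduct_perturbationMatrix_some, he w, hn]
    ring
  have h3 : (1 : ℝ) ≤ Fintype.card I := by exact_mod_cast Fintype.card_pos
  rw [dotProduct, Fintype.sum_option, Finset.sum_congr rfl fun w _ => h2 w, ← Finset.mul_sum,
    sum_midIndicator, h1, dotProduct_perturbationMatrix_none, hn,
    Finset.sum_congr rfl fun i _ => he (.inr (i, 0))]
  have h4 : 0 < e ^ 2 := by positivity
  set d : ℝ := (Fintype.card I : ℝ)
  -- On the kernel line the quadratic form is e² times this cubic, which is positive from d = 1 on.
  have h5 : 0 < d ^ 3 + 2 * d ^ 2 - d - 1 := by nlinarith [sq_nonneg d]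
  simp only [Finset.sum_const, Finset.card_univ, nsmul_eq_mul]
  calc (0 : ℝ) < e ^ 2 * (d ^ 3 + 2 * d ^ 2 - d - 1) := mul_pos h4 h5
    _ = _ := by ring

theorem exists_mem_contractLit {j : I} {J : Type} [Fintype J] {c : Fin 3}
    {ρ π : Equiv.Perm (Fin 3)} {e : {i // i ≠ j} ≃ J} {H : SimpleGraph (Fin 3 ⊕ (J × Fin 3))}
    (hH : ∀ x ∈ fracStab H,
      substPoint (contractLit c ρ π e) x ∈ fracStab (stretchedClique s I))
    {x : Fin 3 ⊕ (J × Fin 3) → ℝ} (hx : x ∈ LSPlus^[n] (fracStab H)) {t : ℝ}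
    (hsum : t < ∑ v, x v) :
    ∃ z ∈ LSPlus^[n] (fracStab (stretchedClique s I)), z (.inl c) = 0 ∧
      (∀ a, a ≠ 0 → z (.inr (j, 0)) + z (.inr (j, a)) = 1) ∧ t + 1 < ∑ v, z v := by
  refine ⟨_, substPoint_mem_iterate_LSPlus (convex_fracStab H) hH n x hx, ?_, fun a ha => ?_, ?_⟩
  · simp [substPoint_contractLit_inl]
  · simp [substPoint_contractLit_self, ha]
  · rw [sum_substPoint_contractLit]
    linarith

/-- The order and `s` are quantified inside the induction because the contractions pass to
suborders, to a reversed order and to `s = False`. -/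
theorem exists_sum_gt_of_card (n : ℕ) : ∀ (I : Type) [LinearOrder I] [Fintype I] (s : Prop),
    Fintype.card I = n → ∃ x ∈ LSPlus^[n] (fracStab (stretchedClique s I)),
      (n + 1 : ℝ) < ∑ v, x v := by
  induction n with
  | zero =>
    intro I _ _ s hI
    have : IsEmpty I := Fintype.card_eq_zero_iff.1 hI
    -- Only the triangle is left, where the half-integral point has sum 3/2 > 1.
    refine ⟨fun _ => 1 / 2, ⟨fun i => by norm_num, fun i j _ => by norm_num⟩, ?_⟩
    simp
    norm_num
  | succ n ih =>
    intro I _ _ s hI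
    have hne : Nonempty I := Fintype.card_pos_iff.1 (by omega)
    obtain ⟨hi, hhi⟩ := Finite.exists_max (id : I → I)
    obtain ⟨lo, hlo⟩ := Finite.exists_min (id : I → I)
    simp only [id] at hhi hlo
    have hcardI : (Fintype.card I : ℝ) = n + 1 := by rw [hI]; push_cast; ring
    have hcard : ∀ j : I, Fintype.card {i // i ≠ j} = n := fun j => by
      rw [Fintype.card_subtype_compl, Fintype.card_subtype_eq, hI]; rfl
    have hcard' : ∀ j : I, Fintype.card {i // i ≠ j}ᵒᵈ = n := hcard
    have hconv := convex_iterate_LSPlus (convex_fracStab (stretchedClique s I)) n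
    have hmid : ∀ j : I, ∃ x ∈ LSPlus^[n] (fracStab (stretchedClique s I)),
        (∀ a, x (.inr (j, a)) = if a = 0 then 1 else 0) ∧
          (Fintype.card I + 1 : ℝ) < ∑ v, x v := fun j => by
      obtain ⟨x, hx, hsum⟩ := ih {i // i ≠ j} s (hcard j)
      refine ⟨_, substPoint_mem_iterate_LSPlus (convex_fracStab _)
        (fun _ => substPoint_addPathLit_mem) n x hx, substPoint_addPathLit_self x, ?_⟩
      rw [sum_substPoint_addPathLit, hcardI]
      linarith
    have hclique : ∀ u : Fin 3, IsFeasibleDirection (LSPlus^[n] (fracStab (stretchedClique s I)))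
        ((tightFamily s I).filter (.inl u ∉ ·)) incidence
        (fun a => perturbationMatrix I a none - perturbationMatrix I a (some (.inl u))) := by
      intro u
      fin_cases u <;> simp only [Fin.zero_eta, Fin.mk_one, Fin.reduceFinMk]
      · obtain ⟨x, hx, hsum⟩ := ih {i // i ≠ hi} s (hcard hi)
        obtain ⟨z, hz, hz0, hz1, hz2⟩ :=
          exists_mem_contractLit (fun _ => contractLit_max_mem hhi) hx hsum
        exact isFeasibleDirection_of_classes (p := .inr (hi, 0)) (q := .inr (hi, 2)) rfl
          (by simp) (by simp [midIndicator]) (fun f hf => annihilator_zero hhi hf)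
          (c := .inl 2) (σ := none) (by simp [mem_tightSet_inl]) (by simp [mem_tightSet_inr_of_ne])
          (by simp [mem_tightSet_inr_of_ne]) hz hz0 (hz1 2 (by decide)) (by rwa [hcardI])
      · obtain ⟨x, hx, hsum⟩ := ih {i // i ≠ hi}ᵒᵈ False (hcard' hi)
        obtain ⟨z, hz, hz0, hz1, hz2⟩ :=
          exists_mem_contractLit (fun _ => contractLit_dual_one_mem hhi) hx hsum
        refine isFeasibleDirection_of_classes (p := .inr (hi, 0)) (q := .inr (hi, 2)) rfl
          (by simp) (by simp [midIndicator]) (fun f hf => ?_)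
          (c := .inl 2) (σ := none) (by simp [mem_tightSet_inl]) (by simp [mem_tightSet_inr_of_ne])
          (by simp [mem_tightSet_inr_of_ne]) hz hz0 (hz1 2 (by decide)) (by rwa [hcardI])
        obtain ⟨e, he⟩ := annihilator_one hf
        exact ⟨e, e, fun w h _ _ => he w h, he _ (by simp), he _ (by simp)⟩
      · obtain ⟨x, hx, hsum⟩ := ih {i // i ≠ lo} s (hcard lo)
        obtain ⟨z, hz, hz0, hz1, hz2⟩ :=
          exists_mem_contractLit (fun _ => contractLit_min_mem hlo) hx hsum
        exact isFeasibleDirection_of_classes (p := .inr (lo, 0)) (q := .inr (lo, 1)) rfl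
          (by simp) (by simp [midIndicator]) (fun f hf => annihilator_two hlo hf)
          (c := .inl 0) (σ := none) (by simp [mem_tightSet_inl]) (by simp [mem_tightSet_inr_of_ne])
          (by simp [mem_tightSet_inr_of_ne]) hz hz0 (hz1 1 (by decide)) (by rwa [hcardI])
    have hend : ∀ (j : I) (a : Fin 3), a ≠ 0 →
        IsFeasibleDirection (LSPlus^[n] (fracStab (stretchedClique s I)))
          ((tightFamily s I).filter (.inr (j, a) ∉ ·)) incidence
          (fun b => perturbationMatrix I b none - perturbationMatrix I b (some (.inr (j, a)))) := by
      intro j a ha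
      obtain ⟨x, hx, hxj, hsum⟩ := hmid j
      fin_cases a <;> simp only [Fin.zero_eta, Fin.mk_one, Fin.reduceFinMk]
      · simp at ha
      · exact isFeasibleDirection_of_classes (p := .inr (j, 0)) (q := .inr (j, 2))
          (by simp [midIndicator]) (by simp) (by simp [midIndicator])
          (fun f hf => annihilator_end_one hf) (c := .inl 0) (σ := none)
          (by simp [mem_tightSet_inr_of_ne]) (by simp [mem_tightSet_inr_of_ne])
          (by simp [mem_tightSet_inr_of_ne]) hx (by simp [hxj]) (by simp [hxj]) hsum
      · exact isFeasibleDirection_of_classes (p := .inr (j, 0)) (q := .inr (j, 1))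
          (by simp [midIndicator]) (by simp) (by simp [midIndicator])
          (fun f hf => annihilator_end_two hf) (c := .inl 0) (σ := none)
          (by simp [mem_tightSet_inr_of_ne]) (by simp [mem_tightSet_inr_of_ne])
          (by simp [mem_tightSet_inr_of_ne]) hx (by simp [hxj]) (by simp [hxj]) hsum
    have hcolzero : ∀ v : Fin 3 ⊕ (I × Fin 3), midIndicator v = 0 →
        IsFeasibleDirection (LSPlus^[n] (fracStab (stretchedClique s I)))
          ((tightFamily s I).filter (v ∈ ·)) incidence
          (fun b => perturbationMatrix I b (some v)) := by
      intro v hv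
      obtain ⟨x, hx, -⟩ := hmid hi
      refine ⟨0, zero_mem_homCone ⟨x, hx⟩, fun f _ => ?_⟩
      rw [dotProduct_perturbationMatrix_some, hv, dotProduct_zero]
      ring
    have hmain := exists_mem_LSPlus_of_perturbation hconv (tightFamily s I)
      ⟨_, tightSet_mem_tightFamily (.inl 0) none⟩
      (fun T hT => incidence_mem_homCone n (isIndepSet_of_mem_tightFamily hT))
      (fun T hT => card_of_mem_tightFamily hT) (perturbationMatrix I)
      perturbationMatrix_isHermitian ?_ ?_ ?_ ?_ ?_
    · obtain ⟨x, hx, hsum⟩ := hmain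
      refine ⟨x, by rwa [Function.iterate_succ_apply'], ?_⟩
      rw [hI] at hsum
      exact_mod_cast hsum
    · rintro (_ | v) <;> simp [perturbationMatrix]
    · rintro (u | ⟨j, a⟩)
      · exact hcolzero _ rfl
      · by_cases ha : a = 0
        · subst ha
          obtain ⟨x, hx, hxj, hsum⟩ := hmid j
          exact isFeasibleDirection_mid hx hxj hsum
        · exact hcolzero _ (by simp [midIndicator, ha])
    · rintro (u | ⟨j, a⟩)
      · exact hclique u
      · by_cases ha : a = 0
        · subst ha
          exact isFeasibleDirection_mid_compl j
        · exact hend j a ha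
    · intro f hf0 hf
      exact dotProduct_perturbationMatrix_mulVec_pos hf0 fun c σ _ =>
        hf _ (tightSet_mem_tightFamily c σ)
    -- The bound to beat is -(d + 1)², and -(d + 2) d exceeds it by exactly 1.
    · simp only [perturbationMatrix]
      rw [← Finset.mul_sum, sum_midIndicator]
      push_cast
      nlinarith

end LowerBound

/-! ### The rank of a stretched clique -/

section Rank

variable {s : Prop} {I : Type} [LinearOrder I] [Fintype I]

/-- In a stable set a path contributes at most 1 unless both its ends are chosen. Two such paths
would contain an edge between them, and one such path excludes the whole triangle; so the total is
at most one more than the number of paths. -/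
theorem sum_le_of_mem_integerHull {x : Fin 3 ⊕ (I × Fin 3) → ℝ}
    (hx : x ∈ integerHull (fracStab (stretchedClique s I))) :
    ∑ v, x v ≤ Fintype.card I + 1 := by
  have hconv : Convex ℝ {x : Fin 3 ⊕ (I × Fin 3) → ℝ | ∑ v, x v ≤ Fintype.card I + 1} := by
    refine convex_halfSpace_le ⟨fun x y => ?_, fun c x => ?_⟩ _
    · simp [Finset.sum_add_distrib]
    · simp only [Pi.smul_apply, smul_eq_mul, Finset.mul_sum]
  refine convexHull_min (fun x hx => ?_) hconv hx
  obtain ⟨⟨h0, hE⟩, h01⟩ := hx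
  have hnn : ∀ v, 0 ≤ x v := fun v => (h0 v).1
  have hmid : ∀ i, ∀ a, a = 1 ∨ a = 2 → x (.inr (i, 0)) + x (.inr (i, a)) ≤ 1 := fun i a ha =>
    hE _ _ (stretchedClique_adj_inr.2 (Or.inl ⟨rfl, Or.inl ⟨rfl, ha⟩⟩))
  have htri : ∀ u v : Fin 3, u ≠ v → x (.inl u) + x (.inl v) ≤ 1 := fun u v h =>
    hE _ _ (stretchedClique_adj_inl.2 h)
  have hpath : ∀ i, ¬ (x (.inr (i, 1)) = 1 ∧ x (.inr (i, 2)) = 1) →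
      ∑ a, x (.inr (i, a)) ≤ 1 := by
    intro i hi
    rw [Fin.sum_univ_three]
    have h1 := hmid i 1 (by simp)
    have h2 := hmid i 2 (by simp)
    rcases h01 (.inr (i, 1)) with h | h <;> rcases h01 (.inr (i, 2)) with h' | h'
    · have := (h0 (.inr (i, 0))).2
      linarith
    · linarith
    · linarith
    · exact absurd ⟨h, h'⟩ hi
  rw [Set.mem_ofPred_eq, Fintype.sum_sum_type, Fintype.sum_prod_type, Fin.sum_univ_three]
  by_cases hex : ∃ j, x (.inr (j, 1)) = 1 ∧ x (.inr (j, 2)) = 1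
  · obtain ⟨j, hj1, hj2⟩ := hex
    have h1 := hE _ _ (stretchedClique_adj_inr_inl (s := s) (i := j) (a := 2) (v := 0) |>.2
      (by simp))
    have h2 := hE _ _ (stretchedClique_adj_inr_inl (s := s) (i := j) (a := 1) (v := 1) |>.2
      (by simp))
    have h3 := hE _ _ (stretchedClique_adj_inr_inl (s := s) (i := j) (a := 1) (v := 2) |>.2
      (by simp))
    have hj : ∑ a, x (.inr (j, a)) ≤ 2 := by
      rw [Fin.sum_univ_three]
      linarith [hmid j 1 (by simp)]
    have hother : ∀ i ∈ Finset.univ.erase j, ∑ a, x (.inr (i, a)) ≤ 1 := by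
      intro i hi
      refine hpath i fun ⟨hi1, hi2⟩ => ?_
      rcases lt_or_gt_of_ne (Finset.ne_of_mem_erase hi) with h | h
      · have := hE _ _ (stretchedClique_adj_inr (s := s) (a := 2) (b := 1) |>.2
          (Or.inr (Or.inl ⟨h, rfl, rfl⟩)))
        linarith
      · have := hE _ _ (stretchedClique_adj_inr (s := s) (a := 2) (b := 1) |>.2
          (Or.inr (Or.inl ⟨h, rfl, rfl⟩)))
        linarith
    have hsum := Finset.sum_le_sum hother
    rw [Finset.sum_const, Finset.card_erase_of_mem (Finset.mem_univ j), nsmul_eq_mul,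
      Finset.card_univ, Nat.cast_sub (Fintype.card_pos_iff.2 ⟨j⟩)] at hsum
    rw [← Finset.add_sum_erase _ _ (Finset.mem_univ j)]
    push_cast at hsum
    linarith
  · push Not at hex
    have hsum := Finset.sum_le_sum fun i (_ : i ∈ Finset.univ) => hpath i fun h => hex i h.1 h.2
    simp only [Finset.sum_const, Finset.card_univ, nsmul_eq_mul, mul_one] at hsum
    have h1 := htri 0 1 (by decide)
    have h2 := htri 0 2 (by decide)
    have h3 := htri 1 2 (by decide)
    rcases h01 (.inl 0) with h | h
    · linarith
    · linarith [hnn (.inl 1), hnn (.inl 2)]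

theorem card_stretchedClique_vertices {I : Type} [Fintype I] :
    Fintype.card (Fin 3 ⊕ (I × Fin 3)) = 3 * (Fintype.card I + 1) := by
  simp
  ring

theorem isEllMinimal_stretchedClique (s : Prop) :
    IsEllMinimal (Fintype.card I + 1) (stretchedClique s I) := by
  refine ⟨⟨iterate_LSPlus_eq_integerHull _ card_stretchedClique_vertices.le, fun m hm => ?_⟩,
    card_stretchedClique_vertices⟩
  by_contra! hlt
  obtain ⟨x, hx, hsum⟩ := exists_sum_gt_of_card _ I s rfl
  have hx' := iterate_LSPlus_antitone (convex_fracStab (stretchedClique s I))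
    (Nat.lt_succ_iff.1 hlt) hx
  simp only at hx'
  rw [show LSPlus^[m] _ = _ from hm] at hx'
  exact absurd (sum_le_of_mem_integerHull hx') (not_le.2 hsum)

end Rank

/-! ### Edge counts and densities -/

section Density

variable {I : Type} [LinearOrder I] [Fintype I]

theorem two_mul_ncard_edgeSet {V : Type*} [Fintype V] (G : SimpleGraph V)
    [DecidableRel G.Adj] :
    2 * (G.edgeSet.ncard : ℝ) = ∑ v, ∑ w, if G.Adj v w then (1 : ℝ) else 0 := by
  classical
  have h := G.sum_degrees_eq_twice_card_edges
  have h' : G.edgeSet.ncard = G.edgeFinset.card := by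
    rw [Set.ncard_eq_toFinset_card', SimpleGraph.edgeFinset]
  rw [h']
  have h2 : (2 * G.edgeFinset.card : ℝ) = ((∑ v, G.degree v : ℕ) : ℝ) := by rw [h]; push_cast; ring
  rw [h2]
  push_cast
  refine Finset.sum_congr rfl fun v _ => ?_
  rw [← SimpleGraph.card_neighborFinset_eq_degree, SimpleGraph.neighborFinset_eq_filter,
    Finset.sum_boole]

open Classical in
-- Three triangle edges, five edges for each path, one for each pair of paths, and under `s` one
-- more for each path.
theorem two_mul_ncard_edgeSet_stretchedClique (s : Prop) :
    2 * ((stretchedClique s I).edgeSet.ncard : ℝ) =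
      6 + 10 * Fintype.card I + Fintype.card I * (Fintype.card I - 1) +
        if s then 2 * (Fintype.card I : ℝ) else 0 := by
  have hinl : ∀ (i : I) (a v : Fin 3), (stretchedClique s I).Adj (.inl v) (.inr (i, a)) ↔
      (a = 1 ∧ (v = 1 ∨ v = 2)) ∨ (a = 2 ∧ v = 0) ∨ (a = 2 ∧ v = 1 ∧ s) := fun i a v => by
    rw [SimpleGraph.adj_comm, stretchedClique_adj_inr_inl]
  have hpairs : ∑ i : I, ∑ j : I, (if i < j then (1 : ℝ) else 0) +
      ∑ i : I, ∑ j : I, (if j < i then (1 : ℝ) else 0) =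
      Fintype.card I * (Fintype.card I - 1) := by
    have : ∀ i j : I, (if i < j then (1 : ℝ) else 0) + (if j < i then (1 : ℝ) else 0) =
        1 - if i = j then 1 else 0 := by
      intro i j
      rcases lt_trichotomy i j with h | h | h
      · simp [h, h.not_gt, h.ne]
      · simp [h]
      · simp [h, h.not_gt, h.ne']
    simp only [← Finset.sum_add_distrib, this, Finset.sum_sub_distrib]
    simp
    ring
  rw [two_mul_ncard_edgeSet]
  simp only [Fintype.sum_sum_type, Fintype.sum_prod_type, Fin.sum_univ_three,
    stretchedClique_adj_inl, stretchedClique_adj_inr_inl, stretchedClique_adj_inr, hinl]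
  simp [Finset.sum_add_distrib]
  rw [← hpairs]
  split_ifs <;> simp <;> ring

end Density

theorem minimalDensities_finite (ℓ : ℕ) : (minimalDensities ℓ).Finite := by
  classical
  refine ((Set.finite_Iic ((3 * ℓ).choose 2)).image
    fun m : ℕ => (m : ℝ) / ((3 * ℓ).choose 2 : ℝ)).subset ?_
  rintro d ⟨V, _, G, hG, rfl⟩
  refine ⟨G.edgeSet.ncard, ?_, by simp only [graphEdgeDensity, hG.2]⟩
  rw [Set.mem_Iic, ← hG.2, Set.ncard_eq_toFinset_card']
  exact G.card_edgeFinset_le_card_choose_two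

theorem graphA_eq_stretchedClique {k : ℕ} {S : Finset ℕ} {s : Prop}
    (h : ∀ i ∈ Finset.Icc 4 k, i ∈ S ↔ s) :
    graphA k S = stretchedClique s {i : ℕ // i ∈ Finset.Icc 4 k} := by
  have : AEdge k S = StretchedEdge s {i : ℕ // i ∈ Finset.Icc 4 k} := by
    ext v w
    rcases v with u | ⟨i, a⟩ <;> rcases w with u' | ⟨j, b⟩
    · rfl
    · rfl
    · simp only [AEdge, StretchedEdge, h i.1 i.2]
    · rfl
  rw [graphA, this, stretchedClique]

theorem card_Icc_subtype (ℓ : ℕ) :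
    Fintype.card (Finset.Icc 4 (ℓ + 2) : Finset ℕ) = ℓ - 1 := by
  rw [Fintype.card_coe, Nat.card_Icc]
  omega

theorem graphEdgeDensity_graphA {ℓ : ℕ} (hℓ : 1 ≤ ℓ) {S : Finset ℕ} {s : Prop} [Decidable s]
    (h : ∀ i ∈ Finset.Icc 4 (ℓ + 2), i ∈ S ↔ s) :
    graphEdgeDensity (graphA (ℓ + 2) S) =
      ((ℓ : ℝ) ^ 2 + 7 * ℓ - 2 + if s then 2 * (ℓ - 1 : ℝ) else 0) /
        (9 * (ℓ : ℝ) ^ 2 - 3 * ℓ) := by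
  have h1 := two_mul_ncard_edgeSet_stretchedClique (I := (Finset.Icc 4 (ℓ + 2) : Finset ℕ)) s
  have h2 : Fintype.card (AVertex (ℓ + 2)) = 3 * ℓ := by
    rw [card_stretchedClique_vertices, card_Icc_subtype]
    omega
  rw [card_Icc_subtype, Nat.cast_sub hℓ, ← graphA_eq_stretchedClique h] at h1
  rw [graphEdgeDensity, h2, Nat.cast_choose_two]
  push_cast at h1 ⊢
  have hl : (1 : ℝ) ≤ ℓ := by exact_mod_cast hℓ
  have h3 : (0 : ℝ) < 3 * ℓ * (3 * ℓ - 1) := by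
    apply mul_pos <;> linarith
  have h4 : (9 * (ℓ : ℝ) ^ 2 - 3 * ℓ) = 3 * ℓ * (3 * ℓ - 1) := by ring
  rw [h4, div_eq_div_iff (by positivity) h3.ne']
  have h5 : 2 * ((graphA (ℓ + 2) S).edgeSet.ncard : ℝ) =
      (ℓ : ℝ) ^ 2 + 7 * ℓ - 2 + if s then 2 * (ℓ - 1 : ℝ) else 0 := by
    rw [h1]
    split_ifs <;> ring
  rw [← h5]
  ring

theorem isEllMinimal_graphA {ℓ : ℕ} (hℓ : 1 ≤ ℓ) {S : Finset ℕ} {s : Prop}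
    (h : ∀ i ∈ Finset.Icc 4 (ℓ + 2), i ∈ S ↔ s) : IsEllMinimal ℓ (graphA (ℓ + 2) S) := by
  have := isEllMinimal_stretchedClique (I := (Finset.Icc 4 (ℓ + 2) : Finset ℕ)) s
  rw [card_Icc_subtype, ← graphA_eq_stretchedClique h, Nat.sub_add_cancel hℓ] at this
  exact this

theorem proposition5p5 (ℓ : ℕ) (hℓ : 1 ≤ ℓ) :
    -- the minimum and the maximum edge density among `ℓ`-minimal graphs exist
    IsLeast (minimalDensities ℓ) (dMinus ℓ) ∧
    IsGreatest (minimalDensities ℓ) (dPlus ℓ) ∧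
    -- the two bounds
    dMinus ℓ ≤ ((ℓ : ℝ) ^ 2 + 7 * ℓ - 2) / (9 * (ℓ : ℝ) ^ 2 - 3 * ℓ) ∧
    dPlus ℓ ≥ ((ℓ : ℝ) ^ 2 + 9 * ℓ - 4) / (9 * (ℓ : ℝ) ^ 2 - 3 * ℓ) ∧
    -- the witnesses, with `k = ℓ + 2`
    (IsEllMinimal ℓ (graphA (ℓ + 2) ∅) ∧
      graphEdgeDensity (graphA (ℓ + 2) ∅) =
        ((ℓ : ℝ) ^ 2 + 7 * ℓ - 2) / (9 * (ℓ : ℝ) ^ 2 - 3 * ℓ)) ∧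
    (IsEllMinimal ℓ (graphA (ℓ + 2) (Finset.Icc 4 (ℓ + 2))) ∧
      graphEdgeDensity (graphA (ℓ + 2) (Finset.Icc 4 (ℓ + 2))) =
        ((ℓ : ℝ) ^ 2 + 9 * ℓ - 4) / (9 * (ℓ : ℝ) ^ 2 - 3 * ℓ)) := by
  have hE : ∀ i ∈ Finset.Icc 4 (ℓ + 2), i ∈ (∅ : Finset ℕ) ↔ False := by simp
  have hF : ∀ i ∈ Finset.Icc 4 (ℓ + 2), i ∈ Finset.Icc 4 (ℓ + 2) ↔ True := fun i hi => by
    simp only [hi]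
  have dE := graphEdgeDensity_graphA hℓ hE
  have dF := graphEdgeDensity_graphA hℓ hF
  rw [if_neg not_false, add_zero] at dE
  rw [if_pos trivial] at dF
  have e : (ℓ : ℝ) ^ 2 + 7 * ℓ - 2 + 2 * (ℓ - 1) = (ℓ : ℝ) ^ 2 + 9 * ℓ - 4 := by ring
  rw [e] at dF
  have mE := isEllMinimal_graphA hℓ hE
  have mF := isEllMinimal_graphA hℓ hF
  have hfin := minimalDensities_finite ℓ
  have memE : graphEdgeDensity (graphA (ℓ + 2) ∅) ∈ minimalDensities ℓ := ⟨_, _, _, mE, rfl⟩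
  have memF : graphEdgeDensity (graphA (ℓ + 2) (Finset.Icc 4 (ℓ + 2))) ∈ minimalDensities ℓ :=
    ⟨_, _, _, mF, rfl⟩
  -- A finite nonempty set attains its infimum and supremum, so no default value of `sInf` or `sSup`
  -- is involved.
  have hmin : IsLeast (minimalDensities ℓ) (dMinus ℓ) :=
    ⟨Set.Nonempty.csInf_mem ⟨_, memE⟩ hfin, fun _ hd => csInf_le hfin.bddBelow hd⟩
  have hmax : IsGreatest (minimalDensities ℓ) (dPlus ℓ) :=
    ⟨Set.Nonempty.csSup_mem ⟨_, memE⟩ hfin, fun _ hd => le_csSup hfin.bddAbove hd⟩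
  exact ⟨hmin, hmax, dE ▸ hmin.2 memE, dF ▸ hmax.2 memF, ⟨mE, dE⟩, ⟨mF, dF⟩⟩
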